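/- Let $n\ge 1$, $d=n+1$, let $\theta=(\theta_1,\dots,\theta_n)^{\top}\in\mathbb R^n$, and let \[ \Lambda=\begin{pmatrix}1&0\\ \theta&E_n\end{pmatrix}^{-1}\mathbb Z^d ,\] where $E_n$ is the $n\times n$ identity matrix. For $s>0$ put \[ \mathcal B(s)=\{(e^{s}z_1,e^{-s/n}z_2,\dots,e^{-s/n}z_d) : \max_i|z_i|\le 1\}\subset\mathbb R^d , \] and for $1\le p\le d$ let $\lambda_p(s)$ be the $p$-th successive minimum of $\mathcal B(s)$ with respect to $\Lambda$, i.e. the infimum of all $r>0$ such that $r\,\mathcal B(s)$ contains $p$ linearly independent points of $\Lambda$. Set \[ \psi_p(s)=\frac{\ln\lambda_p(s)}{s},\qquad \underline\psi_p=\liminf_{s\to+\infty}\psi_p(s),\qquad \overline\psi_p=\limsup_{s\to+\infty}\psi_p(s). \] These lower and upper limits are finite for all $1\le p\le d$. If $1,\theta_1,\dots,\theta_n$ are linearly independent over $\mathbb Q$, then for every integer $1\le p\le d$ \[ (1+\underline\psi_p)\Big(\frac1n-\overline\psi_p\Big)\le(1+\underline\psi_1)\Big(\frac1n-\underline\psi_p\Big)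 \tag{1} \] and \[ (1+\overline\psi_d)\Big(\frac1n-\overline\psi_p\Big)\le(1+\overline\psi_p)\Big(\frac1n-\underline\psi_p\Big). \tag{2} \] Moreover, for each integer $1\le p\le d$, inequality (1) already holds under the weaker hypothesis $\dim_{\mathbb Q}\operatorname{span}_{\mathbb Q}(1,\theta_1,\dots,\theta_n)\ge p$. -/

import Mathlib

open Filter
open scoped Pointwise

noncomputable section

namespace SchmidtSummerer

/-- The `p`-th successive minimum of a set `M` with respect to `Λ`: the infimum of the positive
factors `r` such that `r • M` contains `p` linearly independent points of `Λ`. -/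
def successiveMin {ι : Type*} [Fintype ι] (Λ : Submodule ℤ (ι → ℝ)) (M : Set (ι → ℝ))
    (p : ℕ) : ℝ :=
  sInf {r : ℝ | 0 < r ∧ ∃ v : Fin p → (ι → ℝ),
    LinearIndependent ℝ v ∧ ∀ i, v i ∈ Λ ∧ v i ∈ r • M}

/-- The box `D_τ 𝓑`, where `D_τ` is the diagonal matrix with entries `exp (τ i)` and `𝓑` is the
closed unit ball of the sup-norm (the norm of `ι → ℝ`). -/
def box {ι : Type*} [Fintype ι] [DecidableEq ι] (τ : ι → ℝ) : Set (ι → ℝ) :=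
  (fun z => (Matrix.diagonal fun i => Real.exp (τ i)).mulVec z) '' Metric.closedBall 0 1

/-- `ψ_p(Λ, 𝔗, s) = ln (λ_p(𝓑(s))) / s`. -/
def psi {ι : Type*} [Fintype ι] [DecidableEq ι] (Λ : Submodule ℤ (ι → ℝ)) (T : ℝ → ι → ℝ)
    (p : ℕ) (s : ℝ) : ℝ :=
  Real.log (successiveMin Λ (box (T s)) p) / s

/-- The `p`-th lower Schmidt-Summerer exponent. -/
def lowerExp {ι : Type*} [Fintype ι] [DecidableEq ι] (Λ : Submodule ℤ (ι → ℝ)) (T : ℝ → ι → ℝ)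
    (p : ℕ) : ℝ :=
  liminf (psi Λ T p) atTop

/-- The `p`-th upper Schmidt-Summerer exponent. -/
def upperExp {ι : Type*} [Fintype ι] [DecidableEq ι] (Λ : Submodule ℤ (ι → ℝ)) (T : ℝ → ι → ℝ)
    (p : ℕ) : ℝ :=
  limsup (psi Λ T p) atTop

/-- The block matrix `T_Θ` with rows `(E_m, 0)` and `(Θ, E_n)`. -/
def matT {m n : ℕ} (Θ : Matrix (Fin n) (Fin m) ℝ) :
    Matrix (Fin m ⊕ Fin n) (Fin m ⊕ Fin n) ℝ :=
  Matrix.fromBlocks 1 0 Θ 1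

/-- The lattice `Λ_Θ = T_Θ⁻¹ ℤ^d`, `d = m + n`. -/
def lattice {m n : ℕ} (Θ : Matrix (Fin n) (Fin m) ℝ) : Submodule ℤ (Fin m ⊕ Fin n → ℝ) :=
  (Submodule.span ℤ (Set.range (Pi.basisFun ℝ (Fin m ⊕ Fin n)))).map
    ((matT Θ)⁻¹.mulVecLin.restrictScalars ℤ)

/-- The path `𝔗_Θ`: the first `m` coordinates are `s`, the last `n` are `-m s / n`. -/
def path (m n : ℕ) (s : ℝ) : Fin m ⊕ Fin n → ℝ :=
  Sum.elim (fun _ => s) (fun _ => -(m : ℝ) * s / n)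

end SchmidtSummerer

end

namespace SchmidtSummerer

/-! Write `L_p(s)` for the logarithm of the `p`-th minimum. Both inequalities come from one lattice
vector, or one dual vector, that forces `L_p` to change with slope about `1/n` over a long interval
of time.

For (1), a vector `v` realising a small first minimum is dominated by its first coordinate up to a
time `s₀`, so it contracts under the flow until then. Reducing other short vectors modulo `v`
controls their first coordinate, while the remaining coordinates gain the factor `exp ((s₀ - s₁) /
n)` between `s₁` and `s₀`. Hence `L_p(s₁) ≤ L_p(s₀) - (s₀ - s₁) / n + log 2` as long as `v` is
shorter than the `p`-th minimum at `s₁`. Taking `s₁ = δ s₀` and letting `δ` decrease to `(1 + ψ̲_1)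
/ (1 + ψ̲_p)` gives (1). See `shortSpan_le_of_contracting` and `le_upperExp_of_lt`.

For (2), a large last minimum yields a short dual vector by transference (`exists_short_dual`). Its
form `η = m + ∑ h i * θ i` is nonzero by linear independence, so from some time `s₀` on the dual
vector is dominated by `η` and expands. While it is still small enough, all short lattice points lie
in its kernel, where the first coordinate is determined by the others; this again gives slope `1/n`,
now on `[s₀, γ s₀]`. Letting `γ` increase to `(1 + ψ̄_d) / (1 + ψ̄_p)` gives (2). See
`shortSpan_le_of_expanding` and `lowerExp_le_of_lt`. -/

/-- The vectors whose inner products with all elements of `L` are integers. -/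
def dualSet {E : Type*} [NormedAddCommGroup E] [InnerProductSpace ℝ E] (L : AddSubgroup E) :
    Set E :=
  {y | ∀ l ∈ L, ∃ k : ℤ, inner ℝ y l = k}

/-- A factor above 1 avoids proving that the minimum is attained. The value `6/5` is below 2, which
gives primitivity later, and its square over 4 is `9/25`, small enough for the lifting estimate. -/
theorem exists_almost_shortest {E : Type*} [NormedAddCommGroup E] {S : Set E} {δ : ℝ} (hδ : 0 < δ)
    (hS : ∀ y ∈ S, y ≠ 0 → δ ≤ ‖y‖) (hne : ∃ y ∈ S, y ≠ 0) :
    ∃ y ∈ S, y ≠ 0 ∧ ∀ z ∈ S, z ≠ 0 → ‖y‖ ≤ 6 / 5 * ‖z‖ := by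
  set A : Set ℝ := {r | ∃ y ∈ S, y ≠ 0 ∧ ‖y‖ = r}
  have hA : A.Nonempty := by
    obtain ⟨y, h1, h2⟩ := hne
    exact ⟨_, y, h1, h2, rfl⟩
  have hbd : BddBelow A := ⟨δ, by rintro r ⟨y, h1, h2, rfl⟩; exact hS y h1 h2⟩
  have hpos : 0 < sInf A := hδ.trans_le (le_csInf hA (by
    rintro r ⟨y, h1, h2, rfl⟩; exact hS y h1 h2))
  obtain ⟨r, ⟨y, h1, h2, rfl⟩, hr⟩ := exists_lt_of_csInf_lt hA
    (show sInf A < 6 / 5 * sInf A by linarith)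
  refine ⟨y, h1, h2, fun z hz hz0 => ?_⟩
  have := csInf_le hbd ⟨z, hz, hz0, rfl⟩
  linarith

/-! ### Covering radius and the dual lattice -/

section Covering

variable {E : Type*} [NormedAddCommGroup E] [InnerProductSpace ℝ E] {L : AddSubgroup E}

/-- The values of `y` on `L` form a group `mℤ`, nonzero because `L` spans. Then `m⁻¹ • y` is again
dual, and near-minimality of `y` forces `|m| ≤ 6/5`, so `m = ±1`. -/
theorem dualSet.exists_inner_eq_one (hL : Submodule.span ℝ (L : Set E) = ⊤) {y : E}
    (hy : y ∈ dualSet L) (hy0 : y ≠ 0)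
    (hmin : ∀ z ∈ dualSet L, z ≠ 0 → ‖y‖ ≤ 6 / 5 * ‖z‖) :
    ∃ w ∈ L, inner ℝ y w = (1 : ℝ) := by
  let G : AddSubgroup ℤ :=
    { carrier := {k | ∃ l ∈ L, inner ℝ y l = (k : ℝ)}
      zero_mem' := ⟨0, L.zero_mem, by simp⟩
      add_mem' := by
        rintro a b ⟨l, hl, h⟩ ⟨l', hl', h'⟩
        exact ⟨l + l', L.add_mem hl hl', by rw [inner_add_right, h, h']; push_cast; rfl⟩
      neg_mem' := by
        rintro a ⟨l, hl, h⟩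
        exact ⟨-l, L.neg_mem hl, by rw [inner_neg_right, h]; push_cast; rfl⟩ }
  obtain ⟨m, hm⟩ := Int.subgroup_cyclic G
  rw [← AddSubgroup.zmultiples_eq_closure] at hm
  have hdvd : ∀ l ∈ L, ∃ k : ℤ, inner ℝ y l = (k : ℝ) * m := by
    intro l hl
    obtain ⟨k, hk⟩ := hy l hl
    have : k ∈ AddSubgroup.zmultiples m := hm ▸ (⟨l, hl, hk⟩ : k ∈ G)
    obtain ⟨j, rfl⟩ := AddSubgroup.mem_zmultiples_iff.1 this
    exact ⟨j, by rw [hk]; push_cast [smul_eq_mul]; rfl⟩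
  have hmG : m ∈ G := hm ▸ AddSubgroup.mem_zmultiples m
  obtain ⟨w, hw, hwm⟩ := hmG
  have hm0 : m ≠ 0 := by
    rintro rfl
    have h0 : ∀ x ∈ Submodule.span ℝ (L : Set E), inner ℝ y x = (0 : ℝ) := by
      intro x hx
      induction hx using Submodule.span_induction with
      | mem x hx => obtain ⟨k, hk⟩ := hdvd x hx; simpa using hk
      | zero => simp
      | add x x' _ _ h h' => rw [inner_add_right, h, h', add_zero]
      | smul a x _ h => rw [inner_smul_right, h, mul_zero]
    exact hy0 (inner_self_eq_zero.1 (h0 y (hL ▸ Submodule.mem_top)))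
  have hmR : (m : ℝ) ≠ 0 := by exact_mod_cast hm0
  have hz : (m : ℝ)⁻¹ • y ∈ dualSet L := by
    intro l hl
    obtain ⟨k, hk⟩ := hdvd l hl
    exact ⟨k, by rw [real_inner_smul_left, hk]; field_simp⟩
  have hle := hmin _ hz (smul_ne_zero (inv_ne_zero hmR) hy0)
  rw [norm_smul, norm_inv, Real.norm_eq_abs] at hle
  have hyp : 0 < ‖y‖ := norm_pos_iff.2 hy0
  have hma : |(m : ℝ)| ≤ 6 / 5 := by
    have hmp : 0 < |(m : ℝ)| := abs_pos.2 hmR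
    have h3 : |(m : ℝ)| * ‖y‖ ≤ 6 / 5 * ‖y‖ := by
      calc |(m : ℝ)| * ‖y‖ ≤ |(m : ℝ)| * (6 / 5 * (|(m : ℝ)|⁻¹ * ‖y‖)) := by gcongr
        _ = _ := by field_simp
    exact le_of_mul_le_mul_right h3 hyp
  have hm1 : |m| ≤ 1 := by
    have : ((|m| : ℤ) : ℝ) < 2 := by push_cast; linarith
    have : |m| < 2 := by exact_mod_cast this
    omega
  have : m = 1 ∨ m = -1 := by
    rcases abs_le.1 hm1 with ⟨h1, h2⟩
    omega
  rcases this with rfl | rfl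
  · exact ⟨w, hw, by simpa using hwm⟩
  · exact ⟨-w, L.neg_mem hw, by rw [inner_neg_right, hwm]; simp⟩

/-- A lattice whose dual has no short vectors has small covering radius. -/
theorem exists_covering_const (d : ℕ) : ∃ C : ℝ, 0 ≤ C ∧
    ∀ (E : Type) [NormedAddCommGroup E] [InnerProductSpace ℝ E] [FiniteDimensional ℝ E],
      Module.finrank ℝ E = d → ∀ L : AddSubgroup E, Submodule.span ℝ (L : Set E) = ⊤ →
      Submodule.span ℝ (dualSet L) = ⊤ → ∀ δ : ℝ, 0 < δ →
      (∀ y ∈ dualSet L, y ≠ 0 → δ ≤ ‖y‖) → ∀ x : E, ∃ l ∈ L, ‖x - l‖ ≤ C / δ := by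
  induction d with
  | zero =>
    refine ⟨0, le_rfl, fun E _ _ _ hE L _ _ δ _ _ x => ⟨0, L.zero_mem, ?_⟩⟩
    have := Module.finrank_zero_iff.1 hE
    simp [Subsingleton.elim x 0]
  | succ d ih =>
    obtain ⟨C, hC, ih⟩ := ih
    -- The lattice lies in layers parallel to `y`'s orthogonal complement at distance `1 / ‖y‖ ≤ 1 /
    -- δ`: half a layer costs `1 / 2`. Inside a layer the induction hypothesis applies with `δ / 2`,
    -- which doubles `C`.
    refine ⟨1 / 2 + 2 * C, by positivity, fun E _ _ _ hE L hL hLd δ hδ hmin x => ?_⟩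
    have hne : ∃ y ∈ dualSet L, y ≠ 0 := by
      by_contra! h
      have hbot : Submodule.span ℝ (dualSet L) = ⊥ := Submodule.span_eq_bot.2 h
      rw [hLd] at hbot
      have := (Submodule.subsingleton_iff ℝ).1 (subsingleton_of_top_le_bot hbot.le)
      have := Module.finrank_zero_of_subsingleton (R := ℝ) (M := E)
      omega
    obtain ⟨y, hy, hy0, hymin⟩ := exists_almost_shortest hδ hmin hne
    obtain ⟨w, hw, hyw⟩ := dualSet.exists_inner_eq_one hL hy hy0 hymin
    have hyp : 0 < ‖y‖ := norm_pos_iff.2 hy0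
    set H : Submodule ℝ E := (Submodule.span ℝ {y})ᗮ with hH
    have memH : ∀ {v : E}, v ∈ H ↔ inner ℝ y v = (0 : ℝ) := fun {v} =>
      Submodule.mem_orthogonal_singleton_iff_inner_right
    have : Fact (Module.finrank ℝ E = d + 1) := ⟨hE⟩
    have hHd : Module.finrank ℝ H = d := Submodule.finrank_orthogonal_span_singleton hy0
    set LH : AddSubgroup H := L.comap H.subtype.toAddMonoidHom with hLH
    have memLH : ∀ {v : H}, v ∈ LH ↔ (v : E) ∈ L := Iff.rfl
    -- the projection along `w` maps `L` to `LH`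
    have hspan : Submodule.span ℝ (LH : Set H) = ⊤ := by
      have key : ∀ v ∈ Submodule.span ℝ (L : Set E), ∃ u ∈ Submodule.span ℝ (LH : Set H),
          (u : E) = v - (inner ℝ y v : ℝ) • w := by
        intro v hv
        induction hv using Submodule.span_induction with
        | mem v hv =>
          obtain ⟨k, hk⟩ := hy v hv
          refine ⟨⟨v - (inner ℝ y v : ℝ) • w, memH.2 ?_⟩, Submodule.subset_span ?_, rfl⟩
          · rw [inner_sub_right, inner_smul_right, hyw]; ring
          · change v - (inner ℝ y v : ℝ) • w ∈ L
            rw [hk, Int.cast_smul_eq_zsmul]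
            exact L.sub_mem hv (L.zsmul_mem hw k)
        | zero => exact ⟨0, Submodule.zero_mem _, by simp⟩
        | add v v' _ _ h h' =>
          obtain ⟨u, hu, e⟩ := h
          obtain ⟨u', hu', e'⟩ := h'
          refine ⟨u + u', Submodule.add_mem _ hu hu', ?_⟩
          rw [Submodule.coe_add, e, e', inner_add_right, add_smul]; abel
        | smul a v _ h =>
          obtain ⟨u, hu, e⟩ := h
          refine ⟨a • u, Submodule.smul_mem _ a hu, ?_⟩
          rw [Submodule.coe_smul, e, inner_smul_right, smul_sub, mul_smul]
      rw [eq_top_iff]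
      intro v _
      obtain ⟨u, hu, e⟩ := key v (hL ▸ Submodule.mem_top)
      rw [memH.1 v.2, zero_smul, sub_zero] at e
      rwa [← Subtype.ext e]
    -- Orthogonal projection to `H` carries dual vectors of `L` to dual vectors of `LH`.
    have hspand : Submodule.span ℝ (dualSet LH) = ⊤ := by
      have key : ∀ v ∈ Submodule.span ℝ (dualSet L),
          H.orthogonalProjectionOnto v ∈ Submodule.span ℝ (dualSet LH) := by
        intro v hv
        induction hv using Submodule.span_induction with
        | mem v hv =>
          refine Submodule.subset_span fun l hl => ?_
          obtain ⟨k, hk⟩ := hv l (memLH.1 hl)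
          refine ⟨k, ?_⟩
          rw [← hk]
          exact Submodule.inner_orthogonalProjectionOnto_eq_of_mem_right l v
        | zero => simp
        | add v v' _ _ h h' => rw [map_add]; exact Submodule.add_mem _ h h'
        | smul a v _ h => rw [map_smul]; exact Submodule.smul_mem _ a h
      rw [eq_top_iff]
      intro v _
      have := key v (hLd ▸ Submodule.mem_top)
      rwa [Submodule.orthogonalProjectionOnto_mem_subspace_eq_self] at this
    have hminH : ∀ z ∈ dualSet LH, z ≠ 0 → δ / 2 ≤ ‖z‖ := by
      intro z hz hz0
      -- A dual vector of `LH` lifts to one of `L` by adding the multiple of `y` that makes the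
      -- pairing with `w` an integer; rounding keeps that multiple at most `1 / 2`.
      set c : ℝ := inner ℝ (z : E) w with hc
      set t : ℝ := round c - c with ht
      have ht2 : |t| ≤ 1 / 2 := by rw [ht, abs_sub_comm]; exact abs_sub_round c
      have hzy : inner ℝ (z : E) y = (0 : ℝ) := by rw [real_inner_comm]; exact memH.1 z.2
      have hz' : (z : E) + t • y ∈ dualSet L := by
        intro l hl
        obtain ⟨k, hk⟩ := hy l hl
        have hu : l - k • w ∈ H := by
          rw [memH, inner_sub_right, ← Int.cast_smul_eq_zsmul ℝ, inner_smul_right, hyw, hk]; ring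
        obtain ⟨j, hj⟩ := hz ⟨_, hu⟩ (memLH.2 (L.sub_mem hl (L.zsmul_mem hw k)))
        rw [Submodule.coe_inner] at hj
        simp only at hj
        rw [inner_sub_right, ← Int.cast_smul_eq_zsmul ℝ, inner_smul_right, ← hc] at hj
        refine ⟨j + k * round c, ?_⟩
        rw [inner_add_left, real_inner_smul_left, hk, ht]
        push_cast
        linear_combination hj
      have hsq : ‖(z : E) + t • y‖ ^ 2 = ‖z‖ ^ 2 + t ^ 2 * ‖y‖ ^ 2 := by
        rw [norm_add_sq_real, inner_smul_right, hzy, norm_smul, mul_pow, Real.norm_eq_abs, sq_abs]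
        simp
      have hzp : 0 < ‖z‖ := norm_pos_iff.2 hz0
      have hne : (z : E) + t • y ≠ 0 := by
        intro h0
        rw [h0] at hsq
        simp only [norm_zero] at hsq
        nlinarith [mul_nonneg (sq_nonneg t) (sq_nonneg ‖y‖), pow_pos hzp 2]
      have h1 := hmin _ hz' hne
      have h2 := hymin _ hz' hne
      have h3 : t ^ 2 ≤ 1 / 4 := by
        rw [← sq_abs]; nlinarith [abs_nonneg t]
      have h4 : ‖y‖ ^ 2 ≤ 36 / 25 * ‖(z : E) + t • y‖ ^ 2 := by
        nlinarith
      have h5 : δ ^ 2 ≤ ‖(z : E) + t • y‖ ^ 2 := by gcongr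
      have h6 : t ^ 2 * ‖y‖ ^ 2 ≤ 1 / 4 * ‖y‖ ^ 2 := by gcongr
      -- The added part has square at most `9/25` of the lifted square norm, so `‖z‖ ^ 2 ≥ 16/25 * δ
      -- ^ 2`.
      refine abs_le_of_sq_le_sq' ?_ hzp.le |>.2
      nlinarith
    obtain ⟨c, hc⟩ : ∃ c : ℝ, c = inner ℝ y x := ⟨_, rfl⟩
    -- Shift `x` by a multiple of `w` to the layer nearest to `H`, then project orthogonally to `H`.
    set v : E := x - (round c) • w with hv
    have hyv : inner ℝ y v = c - round c := by
      rw [hv, inner_sub_right, ← Int.cast_smul_eq_zsmul ℝ, inner_smul_right, hyw, hc]; ring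
    set a : ℝ := (c - round c) / ‖y‖ ^ 2 with ha
    have hu : v - a • y ∈ H := by
      rw [memH, inner_sub_right, inner_smul_right, hyv, real_inner_self_eq_norm_sq, ha]
      field_simp
      ring
    obtain ⟨l, hl, hle⟩ := ih H hHd LH hspan hspand (δ / 2) (by positivity) hminH ⟨_, hu⟩
    refine ⟨(l : E) + round c • w, L.add_mem (memLH.1 hl) (L.zsmul_mem hw _), ?_⟩
    have e : x - ((l : E) + round c • w) = (v - a • y - l) + a • y := by rw [hv]; abel
    have hle' : ‖v - a • y - l‖ ≤ C / (δ / 2) := hle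
    have hay : ‖a • y‖ ≤ 1 / 2 / δ := by
      rw [norm_smul, ha, Real.norm_eq_abs, abs_div, abs_of_pos (by positivity : 0 < ‖y‖ ^ 2)]
      calc |c - round c| / ‖y‖ ^ 2 * ‖y‖ = |c - round c| / ‖y‖ := by field_simp
        _ ≤ 1 / 2 / δ := by
          gcongr
          · exact abs_sub_round c
          · exact hmin y hy hy0
    calc ‖x - ((l : E) + round c • w)‖ ≤ C / (δ / 2) + 1 / 2 / δ := by
          rw [e]; exact (norm_add_le _ _).trans (add_le_add hle' hay)
      _ = _ := by field_simp; ring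

end Covering

/-! ### Lattice points in boxes and spans of short points -/

variable {n : ℕ} {Θ : Matrix (Fin n) (Fin 1) ℝ}

/-- The point of `lattice Θ` with integer parameters `q` and `a`. -/
def latticePoint (Θ : Matrix (Fin n) (Fin 1) ℝ) (q : ℤ) (a : Fin n → ℤ) : Fin 1 ⊕ Fin n → ℝ :=
  Sum.elim (fun _ => (q : ℝ)) (fun i => a i - Θ i 0 * q)

theorem inv_matT (Θ : Matrix (Fin n) (Fin 1) ℝ) : (matT Θ)⁻¹ = Matrix.fromBlocks 1 0 (-Θ) 1 := by
  refine Matrix.inv_eq_left_inv ?_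
  rw [matT, Matrix.fromBlocks_multiply]
  simp

theorem inv_matT_mulVec (w : Fin 1 ⊕ Fin n → ℝ) :
    (matT Θ)⁻¹.mulVec w =
      Sum.elim (fun _ => w (Sum.inl 0)) (fun i => w (Sum.inr i) - Θ i 0 * w (Sum.inl 0)) := by
  rw [inv_matT, Matrix.fromBlocks_mulVec]
  funext i
  rcases i with i | i
  · simp [Subsingleton.elim i 0]
  · simp [Matrix.mulVec, dotProduct]
    ring

theorem mem_lattice_iff {v : Fin 1 ⊕ Fin n → ℝ} :
    v ∈ lattice Θ ↔ ∃ q a, v = latticePoint Θ q a := by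
  rw [lattice, Submodule.mem_map]
  constructor
  · rintro ⟨w, hw, rfl⟩
    have hw' := (Module.Basis.mem_span_iff_repr_mem ℤ (Pi.basisFun ℝ (Fin 1 ⊕ Fin n)) w).1 hw
    choose k hk using hw'
    simp only [algebraMap_int_eq, eq_intCast, Pi.basisFun_repr] at hk
    refine ⟨k (Sum.inl 0), fun i => k (Sum.inr i), ?_⟩
    change (matT Θ)⁻¹.mulVec w = _
    rw [inv_matT_mulVec]
    simp only [latticePoint, hk]
  · rintro ⟨q, a, rfl⟩
    refine ⟨Sum.elim (fun _ => (q : ℝ)) (fun i => (a i : ℝ)), ?_, ?_⟩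
    · rw [Module.Basis.mem_span_iff_repr_mem ℤ (Pi.basisFun ℝ (Fin 1 ⊕ Fin n))]
      rintro (i | i)
      · exact ⟨q, by simp⟩
      · exact ⟨a i, by simp⟩
    · change (matT Θ)⁻¹.mulVec _ = _
      rw [inv_matT_mulVec]
      rfl

theorem latticePoint_mem (q : ℤ) (a : Fin n → ℤ) : latticePoint Θ q a ∈ lattice Θ :=
  mem_lattice_iff.2 ⟨q, a, rfl⟩

/-- The points of `lattice Θ` in the box at time `s`, scaled by `exp t`. -/
def shortPoints (Θ : Matrix (Fin n) (Fin 1) ℝ) (s t : ℝ) : Set (Fin 1 ⊕ Fin n → ℝ) :=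
  {v | v ∈ lattice Θ ∧ |v (Sum.inl 0)| ≤ Real.exp (s + t) ∧
    ∀ i, |v (Sum.inr i)| ≤ Real.exp (t - s / n)}

/-- The real span of the short points. -/
def shortSpan (Θ : Matrix (Fin n) (Fin 1) ℝ) (s t : ℝ) : Submodule ℝ (Fin 1 ⊕ Fin n → ℝ) :=
  Submodule.span ℝ (shortPoints Θ s t)

theorem shortPoints_mono {s t t' : ℝ} (h : t ≤ t') : shortPoints Θ s t ⊆ shortPoints Θ s t' :=
  fun _ ⟨h1, h2, h3⟩ => ⟨h1, h2.trans (by gcongr), fun i => (h3 i).trans (by gcongr)⟩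

theorem mem_smul_box_iff {s t : ℝ} {v : Fin 1 ⊕ Fin n → ℝ} :
    v ∈ Real.exp t • box (path 1 n s) ↔
      |v (Sum.inl 0)| ≤ Real.exp (s + t) ∧ ∀ i, |v (Sum.inr i)| ≤ Real.exp (t - s / n) := by
  have e2 : t - s / n = t + -((1 : ℕ) : ℝ) * s / n := by push_cast; ring
  have habs : ∀ c z : ℝ, |Real.exp t * (Real.exp c * z)| = Real.exp t * (Real.exp c * |z|) := by
    intro c z
    rw [abs_mul, abs_mul, abs_of_pos (Real.exp_pos t), abs_of_pos (Real.exp_pos c)]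
  rw [box, Set.mem_smul_set]
  constructor
  · rintro ⟨_, ⟨z, hz, rfl⟩, rfl⟩
    rw [mem_closedBall_zero_iff, pi_norm_le_iff_of_nonneg zero_le_one] at hz
    constructor
    · simp only [Pi.smul_apply, smul_eq_mul, Matrix.mulVec_diagonal, path, Sum.elim_inl]
      rw [habs, add_comm, Real.exp_add]
      gcongr
      exact mul_le_of_le_one_right (Real.exp_pos _).le (hz (Sum.inl 0))
    · intro i
      simp only [Pi.smul_apply, smul_eq_mul, Matrix.mulVec_diagonal, path, Sum.elim_inr]
      rw [habs, e2, Real.exp_add]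
      gcongr
      exact mul_le_of_le_one_right (Real.exp_pos _).le (hz (Sum.inr i))
  · rintro ⟨h1, h2⟩
    refine ⟨(Real.exp t)⁻¹ • v, ⟨fun i => Real.exp (-(path 1 n s i + t)) * v i, ?_, ?_⟩, ?_⟩
    · rw [mem_closedBall_zero_iff, pi_norm_le_iff_of_nonneg zero_le_one]
      have key : ∀ c z : ℝ, |z| ≤ Real.exp c → ‖Real.exp (-c) * z‖ ≤ 1 := by
        intro c z h
        rw [Real.norm_eq_abs, abs_mul, abs_of_pos (Real.exp_pos _), Real.exp_neg]
        rw [inv_mul_le_iff₀ (Real.exp_pos _), mul_one]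
        exact h
      rintro (i | i)
      · rw [Subsingleton.elim i 0]
        exact key _ _ h1
      · refine key _ _ ?_
        have := h2 i
        rw [e2, add_comm] at this
        exact this
    · funext i
      simp only [Matrix.mulVec_diagonal, Pi.smul_apply, smul_eq_mul]
      rw [← mul_assoc, ← Real.exp_add, ← Real.exp_neg]
      congr 2
      ring
    · rw [smul_smul, mul_inv_cancel₀ (Real.exp_pos t).ne', one_smul]

/-- The factors whose infimum is the successive minimum. -/
def radii (Θ : Matrix (Fin n) (Fin 1) ℝ) (p : ℕ) (s : ℝ) : Set ℝ :=
  {r : ℝ | 0 < r ∧ ∃ v : Fin p → (Fin 1 ⊕ Fin n → ℝ),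
    LinearIndependent ℝ v ∧ ∀ i, v i ∈ lattice Θ ∧ v i ∈ r • box (path 1 n s)}

/-- This turns comparisons of successive minima at different times into inclusions of spans. -/
theorem exp_mem_radii_iff {p : ℕ} {s t : ℝ} :
    Real.exp t ∈ radii Θ p s ↔ p ≤ Module.finrank ℝ (shortSpan Θ s t) := by
  constructor
  · rintro ⟨-, v, hv, h⟩
    have h1 := finrank_span_eq_card hv
    rw [Fintype.card_fin] at h1
    rw [← h1]
    refine Submodule.finrank_mono (Submodule.span_mono ?_)
    rintro _ ⟨i, rfl⟩
    exact ⟨(h i).1, mem_smul_box_iff.1 (h i).2⟩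
  · intro h
    obtain ⟨f, hf, -, hfi⟩ := Submodule.exists_fun_fin_finrank_span_eq ℝ (shortPoints Θ s t)
    refine ⟨Real.exp_pos t, fun i => f (Fin.castLE h i), hfi.comp _ (Fin.castLE_injective h), ?_⟩
    exact fun i => ⟨(hf _).1, mem_smul_box_iff.2 (hf _).2⟩

theorem eq_zero_of_abs_latticePoint_lt {a : Fin n → ℤ} {v : Fin 1 ⊕ Fin n → ℝ}
    (hv : v = latticePoint Θ 0 a) (h : ∀ i, |v (Sum.inr i)| < 1) : v = 0 := by
  have ha : ∀ i, a i = 0 := by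
    intro i
    have := h i
    rw [hv] at this
    simp only [latticePoint, Sum.elim_inr, Int.cast_zero, mul_zero, sub_zero] at this
    have : |a i| < 1 := by exact_mod_cast this
    exact Int.abs_lt_one_iff.1 this
  rw [hv]
  funext i
  rcases i with i | i <;> simp [latticePoint, ha]

theorem finrank_shortSpan_pos_iff {s t : ℝ} :
    1 ≤ Module.finrank ℝ (shortSpan Θ s t) ↔ ∃ v ∈ shortPoints Θ s t, v ≠ 0 := by
  rw [Nat.one_le_iff_ne_zero, Ne, Submodule.finrank_eq_zero, shortSpan, Submodule.span_eq_bot]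
  push Not
  rfl

theorem neg_le_of_finrank_pos {s t : ℝ} (hs : 0 ≤ s)
    (h : 1 ≤ Module.finrank ℝ (shortSpan Θ s t)) : -s ≤ t := by
  obtain ⟨v, ⟨hv, h1, h2⟩, hv0⟩ := finrank_shortSpan_pos_iff.1 h
  obtain ⟨q, a, hqa⟩ := mem_lattice_iff.1 hv
  by_contra! hlt
  refine hv0 ?_
  have hq : q = 0 := by
    rw [hqa] at h1
    have : |(q : ℝ)| < 1 := lt_of_le_of_lt h1 (Real.exp_lt_one_iff.2 (by linarith))
    have : |q| < 1 := by exact_mod_cast this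
    exact Int.abs_lt_one_iff.1 this
  subst hq
  refine eq_zero_of_abs_latticePoint_lt hqa fun i => (h2 i).trans_lt (Real.exp_lt_one_iff.2 ?_)
  have : 0 ≤ s / n := by positivity
  linarith

theorem span_eq_top_of_single_mem {K : Submodule ℝ (Fin 1 ⊕ Fin n → ℝ)}
    (h : ∀ i, Pi.single i (1 : ℝ) ∈ K) : K = ⊤ := by
  rw [eq_top_iff, ← (Pi.basisFun ℝ (Fin 1 ⊕ Fin n)).span_eq, Submodule.span_le]
  rintro _ ⟨i, rfl⟩
  rw [Pi.basisFun_apply]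
  exact h i

/-- The lattice basis `(1, -θ)`, `e_1, …, e_n` is fixed, so its last coordinates are bounded by a
constant `A`, and the scaling `s / n + log A` catches all of it. -/
theorem exists_shortSpan_eq_top (Θ : Matrix (Fin n) (Fin 1) ℝ) :
    ∃ c : ℝ, ∀ s : ℝ, 0 ≤ s → shortSpan Θ s (s / n + c) = ⊤ := by
  set A : ℝ := 1 + ∑ i, |Θ i 0| with hA
  have hsum : 0 ≤ ∑ i, |Θ i 0| := Finset.sum_nonneg fun _ _ => abs_nonneg _
  have hA1 : 1 ≤ A := by linarith
  have hA0 : 0 < A := by linarith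
  refine ⟨Real.log A, fun s hs => ?_⟩
  have hc : 0 ≤ Real.log A := Real.log_nonneg hA1
  have hsn : 0 ≤ s / n := by positivity
  have h1 : 1 ≤ Real.exp (s + (s / n + Real.log A)) := Real.one_le_exp (by positivity)
  have h2 : Real.exp (s / n + Real.log A - s / n) = A := by
    rw [add_sub_cancel_left, Real.exp_log hA0]
  have hinr : ∀ i, Pi.single (Sum.inr i) (1 : ℝ) ∈ shortSpan Θ s (s / n + Real.log A) := by
    intro i
    have e : Pi.single (Sum.inr i) (1 : ℝ) = latticePoint Θ 0 (Pi.single i 1) := by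
      funext j
      rcases j with j | j
      · simp [latticePoint]
      · by_cases hij : j = i
        · subst hij; simp [latticePoint]
        · simp [latticePoint, hij]
    refine Submodule.subset_span ⟨e ▸ latticePoint_mem _ _, ?_, fun j => ?_⟩
    · simp [(Real.exp_pos _).le]
    · rw [h2]
      refine le_trans ?_ hA1
      by_cases hij : j = i
      · subst hij; simp
      · simp [hij]
  refine span_eq_top_of_single_mem ?_
  rintro (j | i)
  swap
  · exact hinr i
  have hmem : latticePoint Θ 1 0 ∈ shortSpan Θ s (s / n + Real.log A) := by
    refine Submodule.subset_span ⟨latticePoint_mem _ _, ?_, fun j => ?_⟩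
    · simpa [latticePoint] using h1
    · rw [h2]
      simp only [latticePoint, Sum.elim_inr, Pi.zero_apply, Int.cast_zero, Int.cast_one, mul_one,
        zero_sub, abs_neg]
      have : |Θ j 0| ≤ ∑ i, |Θ i 0| := Finset.single_le_sum (f := fun i => |Θ i 0|)
        (fun i _ => abs_nonneg _) (Finset.mem_univ j)
      linarith
  have e : Pi.single (Sum.inl j) (1 : ℝ) =
      latticePoint Θ 1 0 + ∑ i, Θ i 0 • Pi.single (Sum.inr i) (1 : ℝ) := by
    funext k
    rcases k with k | k
    · simp [latticePoint, Subsingleton.elim j k]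
    · simp [latticePoint, Finset.sum_apply, Pi.single_apply]
  rw [e]
  exact Submodule.add_mem _ hmem (Submodule.sum_mem _ fun i _ => Submodule.smul_mem _ _ (hinr i))

/-! ### Logarithms of successive minima -/

/-- The logarithm of the `p`-th successive minimum at time `s`. -/
noncomputable def logMin (Θ : Matrix (Fin n) (Fin 1) ℝ) (p : ℕ) (s : ℝ) : ℝ :=
  Real.log (successiveMin (lattice Θ) (box (path 1 n s)) p)

theorem psi_eq_logMin_div (p : ℕ) (s : ℝ) : psi (lattice Θ) (path 1 n) p s = logMin Θ p s / s :=
  rfl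

section

variable {p : ℕ} {s t : ℝ}

theorem radii_nonempty (hpd : p ≤ n + 1) (hs : 0 ≤ s) : (radii Θ p s).Nonempty := by
  obtain ⟨c, hc⟩ := exists_shortSpan_eq_top Θ
  refine ⟨Real.exp (s / n + c), exp_mem_radii_iff.2 ?_⟩
  rw [hc s hs, finrank_top]
  simpa [add_comm] using hpd

theorem exp_neg_le_of_mem_radii (hp : 1 ≤ p) (hs : 0 ≤ s) {r : ℝ} (hr : r ∈ radii Θ p s) :
    Real.exp (-s) ≤ r := by
  have hr0 : 0 < r := hr.1
  rw [← Real.exp_log hr0] at hr ⊢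
  exact Real.exp_le_exp.2 (neg_le_of_finrank_pos hs (hp.trans (exp_mem_radii_iff.1 hr)))

/-- Positivity of the infimum is what makes its `Real.log` meaningful. -/
theorem exp_neg_le_successiveMin (hp : 1 ≤ p) (hpd : p ≤ n + 1) (hs : 0 ≤ s) :
    Real.exp (-s) ≤ successiveMin (lattice Θ) (box (path 1 n s)) p :=
  le_csInf (radii_nonempty hpd hs) fun _ hr => exp_neg_le_of_mem_radii hp hs hr

theorem neg_le_logMin (hp : 1 ≤ p) (hpd : p ≤ n + 1) (hs : 0 ≤ s) : -s ≤ logMin Θ p s :=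
  (Real.le_log_iff_exp_le ((Real.exp_pos _).trans_le (exp_neg_le_successiveMin hp hpd hs))).2
    (exp_neg_le_successiveMin hp hpd hs)

theorem logMin_le (hp : 1 ≤ p) (hpd : p ≤ n + 1) (hs : 0 ≤ s)
    (h : p ≤ Module.finrank ℝ (shortSpan Θ s t)) : logMin Θ p s ≤ t := by
  have hpos := (Real.exp_pos _).trans_le (exp_neg_le_successiveMin (Θ := Θ) hp hpd hs)
  rw [logMin, Real.log_le_iff_le_exp hpos]
  exact csInf_le ⟨0, fun r hr => hr.1.le⟩ (exp_mem_radii_iff.2 h)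

/-- The strict inequality spares the question whether the infimum is attained; later arguments pay
with an extra `ε`. -/
theorem le_finrank_of_logMin_lt (hp : 1 ≤ p) (hpd : p ≤ n + 1) (hs : 0 ≤ s)
    (h : logMin Θ p s < t) : p ≤ Module.finrank ℝ (shortSpan Θ s t) := by
  have hpos := (Real.exp_pos _).trans_le (exp_neg_le_successiveMin (Θ := Θ) hp hpd hs)
  rw [logMin, Real.log_lt_iff_lt_exp hpos] at h
  obtain ⟨r, hr, hrt⟩ := exists_lt_of_csInf_lt (radii_nonempty hpd hs) h
  have hr0 : 0 < r := hr.1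
  have hr' : Real.exp (Real.log r) ∈ radii Θ p s := by rwa [Real.exp_log hr0]
  refine (exp_mem_radii_iff.1 hr').trans (Submodule.finrank_mono (Submodule.span_mono ?_))
  exact shortPoints_mono ((Real.log_lt_iff_lt_exp hr0).2 hrt).le

theorem exists_logMin_le (Θ : Matrix (Fin n) (Fin 1) ℝ) :
    ∃ c : ℝ, ∀ p : ℕ, 1 ≤ p → p ≤ n + 1 → ∀ s : ℝ, 0 ≤ s → logMin Θ p s ≤ s / n + c := by
  obtain ⟨c, hc⟩ := exists_shortSpan_eq_top Θ
  refine ⟨c, fun p hp hpd s hs => logMin_le hp hpd hs ?_⟩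
  rw [hc s hs, finrank_top]
  simpa [add_comm] using hpd

end

/-! ### Diagonal flow, explicit dual lattice and transference -/

/-- The diagonal flow, as a map into Euclidean space. -/
noncomputable def scaleMap (n : ℕ) (s : ℝ) :
    (Fin 1 ⊕ Fin n → ℝ) →ₗ[ℝ] EuclideanSpace ℝ (Fin 1 ⊕ Fin n) :=
  (WithLp.linearEquiv 2 ℝ (Fin 1 ⊕ Fin n → ℝ)).symm.toLinearMap ∘ₗ
    (Matrix.diagonal (Sum.elim (fun _ => Real.exp (-s)) (fun _ => Real.exp (s / n)))).mulVecLin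

theorem scaleMap_inl (s : ℝ) (v : Fin 1 ⊕ Fin n → ℝ) (i : Fin 1) :
    scaleMap n s v (Sum.inl i) = Real.exp (-s) * v (Sum.inl i) := by
  simp [scaleMap, Matrix.mulVec_diagonal]

theorem scaleMap_inr (s : ℝ) (v : Fin 1 ⊕ Fin n → ℝ) (i : Fin n) :
    scaleMap n s v (Sum.inr i) = Real.exp (s / n) * v (Sum.inr i) := by
  simp [scaleMap, Matrix.mulVec_diagonal]

theorem scaleMap_surjective (n : ℕ) (s : ℝ) : Function.Surjective (scaleMap n s) := by
  intro x
  refine ⟨Sum.elim (fun i => Real.exp s * x (Sum.inl i))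
    (fun i => Real.exp (-(s / n)) * x (Sum.inr i)), ?_⟩
  ext i
  rcases i with i | i
  · rw [scaleMap_inl, Sum.elim_inl, ← mul_assoc, ← Real.exp_add]; simp
  · rw [scaleMap_inr, Sum.elim_inr, ← mul_assoc, ← Real.exp_add]; simp

/-- The image of the lattice under the flow. -/
noncomputable def scaledLattice (Θ : Matrix (Fin n) (Fin 1) ℝ) (s : ℝ) :
    AddSubgroup (EuclideanSpace ℝ (Fin 1 ⊕ Fin n)) :=
  (lattice Θ).toAddSubgroup.map (scaleMap n s).toAddMonoidHom

theorem mem_scaledLattice_iff {s : ℝ} {x : EuclideanSpace ℝ (Fin 1 ⊕ Fin n)} :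
    x ∈ scaledLattice Θ s ↔ ∃ v ∈ lattice Θ, scaleMap n s v = x := Iff.rfl

theorem span_lattice (Θ : Matrix (Fin n) (Fin 1) ℝ) :
    Submodule.span ℝ (lattice Θ : Set (Fin 1 ⊕ Fin n → ℝ)) = ⊤ := by
  obtain ⟨c, hc⟩ := exists_shortSpan_eq_top Θ
  rw [eq_top_iff, ← hc 0 le_rfl]
  exact Submodule.span_mono fun v hv => hv.1

theorem span_scaledLattice (Θ : Matrix (Fin n) (Fin 1) ℝ) (s : ℝ) :
    Submodule.span ℝ (scaledLattice Θ s : Set (EuclideanSpace ℝ (Fin 1 ⊕ Fin n))) = ⊤ := by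
  have : (scaledLattice Θ s : Set (EuclideanSpace ℝ (Fin 1 ⊕ Fin n))) =
      scaleMap n s '' (lattice Θ : Set (Fin 1 ⊕ Fin n → ℝ)) := rfl
  rw [this, Submodule.span_image, span_lattice, Submodule.map_top,
    LinearMap.range_eq_top.2 (scaleMap_surjective n s)]

theorem inner_scaleMap_latticePoint (s : ℝ) (y : EuclideanSpace ℝ (Fin 1 ⊕ Fin n)) (q : ℤ)
    (a : Fin n → ℤ) : inner ℝ y (scaleMap n s (latticePoint Θ q a)) =
      Real.exp (-s) * y (Sum.inl 0) * q +
        ∑ i, Real.exp (s / n) * y (Sum.inr i) * (a i - Θ i 0 * q) := by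
  rw [PiLp.inner_apply, Fintype.sum_sum_type]
  simp only [scaleMap_inl, scaleMap_inr, latticePoint, Sum.elim_inl, Sum.elim_inr,
    Finset.univ_unique, Finset.sum_singleton, Fin.default_eq_zero, RCLike.inner_apply, conj_trivial]
  congr 1
  · ring
  · exact Finset.sum_congr rfl fun i _ => by ring

/-- Pairing with the lattice basis `e_i`, `(1, -θ)` reads off `h i` and then `m`. -/
theorem mem_dualSet_scaledLattice_iff {s : ℝ} {y : EuclideanSpace ℝ (Fin 1 ⊕ Fin n)} :
    y ∈ dualSet (scaledLattice Θ s) ↔ ∃ (m : ℤ) (h : Fin n → ℤ),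
      Real.exp (-s) * y (Sum.inl 0) = m + ∑ i, h i * Θ i 0 ∧
        ∀ i, Real.exp (s / n) * y (Sum.inr i) = h i := by
  constructor
  · intro hy
    have h1 : ∀ i, ∃ k : ℤ, Real.exp (s / n) * y (Sum.inr i) = k := by
      intro i
      obtain ⟨k, hk⟩ := hy _ (mem_scaledLattice_iff.2
        ⟨_, latticePoint_mem (Θ := Θ) 0 (Pi.single i 1), rfl⟩)
      refine ⟨k, ?_⟩
      rw [← hk, inner_scaleMap_latticePoint]
      simp [Pi.single_apply]
    choose h hh using h1
    obtain ⟨m, hm⟩ := hy _ (mem_scaledLattice_iff.2 ⟨_, latticePoint_mem (Θ := Θ) 1 0, rfl⟩)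
    refine ⟨m, h, ?_, hh⟩
    rw [inner_scaleMap_latticePoint] at hm
    simp only [hh, Pi.zero_apply, Int.cast_zero, Int.cast_one, mul_one, zero_sub, mul_neg,
      Finset.sum_neg_distrib] at hm
    linarith
  · rintro ⟨m, h, h0, hh⟩ l hl
    obtain ⟨v, hv, rfl⟩ := mem_scaledLattice_iff.1 hl
    obtain ⟨q, a, rfl⟩ := mem_lattice_iff.1 hv
    refine ⟨m * q + ∑ i, h i * a i, ?_⟩
    rw [inner_scaleMap_latticePoint, h0]
    simp only [hh]
    push_cast
    rw [add_mul, Finset.sum_mul, add_assoc, ← Finset.sum_add_distrib]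
    congr 1
    exact Finset.sum_congr rfl fun i _ => by ring

theorem span_dualSet_scaledLattice (Θ : Matrix (Fin n) (Fin 1) ℝ) (s : ℝ) :
    Submodule.span ℝ (dualSet (scaledLattice Θ s)) = ⊤ := by
  have h0 : EuclideanSpace.single (Sum.inl 0) (1 : ℝ) ∈
      Submodule.span ℝ (dualSet (scaledLattice Θ s)) := by
    have : Real.exp s • EuclideanSpace.single (Sum.inl 0) (1 : ℝ) ∈
        dualSet (scaledLattice Θ s) := by
      refine mem_dualSet_scaledLattice_iff.2 ⟨1, 0, ?_, ?_⟩
      · simp [← Real.exp_add]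
      · simp
    exact (Submodule.smul_mem_iff _ (Real.exp_pos s).ne').1 (Submodule.subset_span this)
  have hi : ∀ i, EuclideanSpace.single (Sum.inr i) (1 : ℝ) ∈
      Submodule.span ℝ (dualSet (scaledLattice Θ s)) := by
    intro i
    have : Real.exp (-(s / n)) • EuclideanSpace.single (Sum.inr i) (1 : ℝ) +
        (Real.exp s * Θ i 0) • EuclideanSpace.single (Sum.inl 0) (1 : ℝ) ∈
        dualSet (scaledLattice Θ s) := by
      refine mem_dualSet_scaledLattice_iff.2 ⟨0, Pi.single i 1, ?_, ?_⟩
      · simp [← mul_assoc, ← Real.exp_add, Pi.single_apply]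
      · intro j
        by_cases hj : j = i
        · subst hj; simp [← Real.exp_add]
        · simp [hj]
    have h1 := Submodule.sub_mem _ (Submodule.subset_span this)
      (Submodule.smul_mem _ (Real.exp s * Θ i 0) h0)
    rw [add_sub_cancel_right] at h1
    exact (Submodule.smul_mem_iff _ (Real.exp_pos _).ne').1 h1
  rw [eq_top_iff, ← (EuclideanSpace.basisFun (Fin 1 ⊕ Fin n) ℝ).toBasis.span_eq,
    Submodule.span_le]
  rintro _ ⟨i, rfl⟩
  rw [OrthonormalBasis.coe_toBasis, EuclideanSpace.basisFun_apply]
  rcases i with i | i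
  · rw [Subsingleton.elim i 0]; exact h0
  · exact hi i

/-- If the short vectors of a lattice do not span, the dual lattice has a short vector. -/
theorem exists_short_dual (n : ℕ) : ∃ C : ℝ, 0 < C ∧ ∀ (Θ : Matrix (Fin n) (Fin 1) ℝ) (s t : ℝ),
    Module.finrank ℝ (shortSpan Θ s t) < n + 1 →
    ∃ (m : ℤ) (h : Fin n → ℤ), ¬ (m = 0 ∧ h = 0) ∧
      |m + ∑ i, h i * Θ i 0| ≤ C * Real.exp (-s - t) ∧
      ∀ i, |(h i : ℝ)| ≤ C * Real.exp (s / n - t) := by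
  obtain ⟨C₀, hC₀, hcov⟩ := exists_covering_const (n + 1)
  -- This makes the covering radius at most `exp t / 3` if no nonzero dual vector is shorter than `C
  -- * exp (-t)`; the `+ 3` keeps `C` positive.
  refine ⟨3 * C₀ + 3, by positivity, fun Θ s t hlt => ?_⟩
  set C := 3 * C₀ + 3 with hC
  have hCpos : 0 < C := by positivity
  set δ := C * Real.exp (-t) with hδ
  have hδpos : 0 < δ := by positivity
  obtain ⟨y, hy, hy0, hyδ⟩ : ∃ y ∈ dualSet (scaledLattice Θ s), y ≠ 0 ∧ ‖y‖ < δ := by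
    by_contra! hmin
    have hfr : Module.finrank ℝ (EuclideanSpace ℝ (Fin 1 ⊕ Fin n)) = n + 1 := by
      simp [add_comm]
    have hcov' := hcov _ hfr (scaledLattice Θ s) (span_scaledLattice Θ s)
      (span_dualSet_scaledLattice Θ s) δ hδpos hmin
    have hrad : C₀ / δ ≤ Real.exp t / 3 := by
      rw [div_le_div_iff₀ hδpos (by norm_num), hδ, mul_comm C, ← mul_assoc, ← Real.exp_add,
        add_neg_cancel, Real.exp_zero, one_mul, hC]
      linarith
    set K : Submodule ℝ (EuclideanSpace ℝ (Fin 1 ⊕ Fin n)) := (shortSpan Θ s t).map (scaleMap n s)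
      with hK
    have hKtop : K ≠ ⊤ := by
      intro h
      have := Submodule.finrank_map_le (scaleMap n s) (shortSpan Θ s t)
      rw [← hK, h, finrank_top, hfr] at this
      omega
    obtain ⟨u, hu, hu0⟩ := Submodule.exists_mem_ne_zero_of_ne_bot
      (mt (Submodule.orthogonal_eq_bot_iff).1 hKtop)
    have hup : 0 < ‖u‖ := norm_pos_iff.2 hu0
    -- A lattice point within `exp t / 3` of `x` has norm at most `exp t`, hence lies in `K`. But
    -- `x` is orthogonal to `K`, so its distance to `K` is `2 / 3 * exp t`.
    set x := (2 / 3 * Real.exp t / ‖u‖) • u with hx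
    have hxn : ‖x‖ = 2 / 3 * Real.exp t := by
      rw [hx, norm_smul, Real.norm_of_nonneg (by positivity)]
      field_simp
    obtain ⟨l, hl, hle⟩ := hcov' x
    have hle' := hle.trans hrad
    have hln : ‖l‖ ≤ Real.exp t := by
      have := norm_sub_norm_le l x
      rw [norm_sub_rev] at this
      linarith
    have hlK : l ∈ K := by
      obtain ⟨v, hv, rfl⟩ := mem_scaledLattice_iff.1 hl
      refine Submodule.mem_map_of_mem (Submodule.subset_span ⟨hv, ?_, fun i => ?_⟩)
      · have h1 := (PiLp.norm_apply_le (scaleMap n s v) (Sum.inl 0)).trans hln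
        rw [scaleMap_inl, Real.norm_eq_abs, abs_mul, abs_of_pos (Real.exp_pos _), Real.exp_neg,
          inv_mul_le_iff₀ (Real.exp_pos _), ← Real.exp_add] at h1
        exact h1
      · have h1 := (PiLp.norm_apply_le (scaleMap n s v) (Sum.inr i)).trans hln
        rw [scaleMap_inr, Real.norm_eq_abs, abs_mul, abs_of_pos (Real.exp_pos _)] at h1
        rwa [Real.exp_sub, le_div_iff₀ (Real.exp_pos _), mul_comm]
    have h0 : inner ℝ l x = (0 : ℝ) := by
      rw [hx, inner_smul_right, hu l hlK, mul_zero]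
    have h1 : inner ℝ (x - l) x = ‖x‖ ^ 2 := by
      rw [inner_sub_left, h0, sub_zero, real_inner_self_eq_norm_sq]
    have h2 := real_inner_le_norm (x - l) x
    rw [h1, hxn] at h2
    have h3 := mul_le_mul_of_nonneg_right hle'
      (by positivity : (0 : ℝ) ≤ 2 / 3 * Real.exp t)
    nlinarith [Real.exp_pos t]
  obtain ⟨m, h, h0, hh⟩ := mem_dualSet_scaledLattice_iff.1 hy
  have hcoord : ∀ i, |y i| ≤ δ := fun i => (PiLp.norm_apply_le y i).trans hyδ.le
  refine ⟨m, h, ?_, ?_, ?_⟩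
  · rintro ⟨rfl, rfl⟩
    refine hy0 ?_
    ext i
    rcases i with i | i
    · rw [Subsingleton.elim i 0]
      simpa [(Real.exp_pos _).ne'] using h0
    · simpa [(Real.exp_pos _).ne'] using hh i
  · rw [← h0, abs_mul, abs_of_pos (Real.exp_pos _)]
    calc Real.exp (-s) * |y (Sum.inl 0)| ≤ Real.exp (-s) * δ := by gcongr; exact hcoord _
      _ = _ := by rw [hδ, sub_eq_add_neg, Real.exp_add]; ring
  · intro i
    rw [← hh i, abs_mul, abs_of_pos (Real.exp_pos _)]
    calc Real.exp (s / n) * |y (Sum.inr i)| ≤ Real.exp (s / n) * δ := by gcongr; exact hcoord _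
      _ = _ := by rw [hδ, sub_eq_add_neg, Real.exp_add]; ring

/-! ### Finiteness of the exponents and their `ε`-characterisations -/

section Exponents

theorem eventually_neg_one_le_psi (Θ : Matrix (Fin n) (Fin 1) ℝ) {p : ℕ} (hp : 1 ≤ p)
    (hpd : p ≤ n + 1) : ∀ᶠ s in atTop, -1 ≤ psi (lattice Θ) (path 1 n) p s := by
  filter_upwards [eventually_gt_atTop 0] with s hs
  rw [psi_eq_logMin_div, le_div_iff₀ hs, neg_one_mul]
  exact neg_le_logMin hp hpd hs.le

theorem eventually_psi_le (Θ : Matrix (Fin n) (Fin 1) ℝ) {p : ℕ} (hp : 1 ≤ p)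
    (hpd : p ≤ n + 1) {ε : ℝ} (hε : 0 < ε) :
    ∀ᶠ s in atTop, psi (lattice Θ) (path 1 n) p s ≤ 1 / n + ε := by
  obtain ⟨c, hc⟩ := exists_logMin_le Θ
  filter_upwards [eventually_gt_atTop 0, eventually_ge_atTop (c / ε)] with s hs hs'
  rw [psi_eq_logMin_div, div_le_iff₀ hs]
  have := hc p hp hpd s hs.le
  rw [div_le_iff₀ hε] at hs'
  calc logMin Θ p s ≤ s / n + c := this
    _ ≤ (1 / n + ε) * s := by ring_nf; ring_nf at hs'; linarith

theorem isBoundedUnder_le_psi (Θ : Matrix (Fin n) (Fin 1) ℝ) {p : ℕ} (hp : 1 ≤ p)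
    (hpd : p ≤ n + 1) : IsBoundedUnder (· ≤ ·) atTop (psi (lattice Θ) (path 1 n) p) :=
  ⟨_, eventually_map.2 (eventually_psi_le Θ hp hpd one_pos)⟩

theorem isBoundedUnder_ge_psi (Θ : Matrix (Fin n) (Fin 1) ℝ) {p : ℕ} (hp : 1 ≤ p)
    (hpd : p ≤ n + 1) : IsBoundedUnder (· ≥ ·) atTop (psi (lattice Θ) (path 1 n) p) :=
  ⟨_, eventually_map.2 (eventually_neg_one_le_psi Θ hp hpd)⟩

variable {p : ℕ}

theorem lowerExp_le_upperExp (hp : 1 ≤ p) (hpd : p ≤ n + 1) :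
    lowerExp (lattice Θ) (path 1 n) p ≤ upperExp (lattice Θ) (path 1 n) p :=
  liminf_le_limsup (isBoundedUnder_le_psi Θ hp hpd) (isBoundedUnder_ge_psi Θ hp hpd)

theorem neg_one_le_lowerExp (hp : 1 ≤ p) (hpd : p ≤ n + 1) :
    -1 ≤ lowerExp (lattice Θ) (path 1 n) p :=
  le_liminf_of_le (isBoundedUnder_le_psi Θ hp hpd).isCoboundedUnder_ge
    (eventually_neg_one_le_psi Θ hp hpd)

theorem upperExp_le (hp : 1 ≤ p) (hpd : p ≤ n + 1) :
    upperExp (lattice Θ) (path 1 n) p ≤ 1 / n :=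
  le_of_forall_pos_le_add fun _ hε =>
    limsup_le_of_le (isBoundedUnder_ge_psi Θ hp hpd).isCoboundedUnder_le
      (eventually_psi_le Θ hp hpd hε)

theorem eventually_lt_logMin (hp : 1 ≤ p) (hpd : p ≤ n + 1) {a : ℝ}
    (ha : a < lowerExp (lattice Θ) (path 1 n) p) : ∀ᶠ s in atTop, a * s < logMin Θ p s := by
  filter_upwards [eventually_gt_atTop 0,
    eventually_lt_of_lt_liminf ha (isBoundedUnder_ge_psi Θ hp hpd)] with s hs h
  rwa [psi_eq_logMin_div, lt_div_iff₀ hs] at h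

theorem eventually_logMin_lt (hp : 1 ≤ p) (hpd : p ≤ n + 1) {b : ℝ}
    (hb : upperExp (lattice Θ) (path 1 n) p < b) : ∀ᶠ s in atTop, logMin Θ p s < b * s := by
  filter_upwards [eventually_gt_atTop 0,
    eventually_lt_of_limsup_lt hb (isBoundedUnder_le_psi Θ hp hpd)] with s hs h
  rwa [psi_eq_logMin_div, div_lt_iff₀ hs] at h

theorem frequently_logMin_lt (hp : 1 ≤ p) (hpd : p ≤ n + 1) {a : ℝ}
    (ha : lowerExp (lattice Θ) (path 1 n) p < a) : ∃ᶠ s in atTop, logMin Θ p s < a * s := by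
  refine ((frequently_lt_of_liminf_lt
    (isBoundedUnder_le_psi Θ hp hpd).isCoboundedUnder_ge ha).and_eventually
      (eventually_gt_atTop 0)).mono fun s ⟨h, hs⟩ => ?_
  rwa [psi_eq_logMin_div, div_lt_iff₀ hs] at h

theorem frequently_lt_logMin (hp : 1 ≤ p) (hpd : p ≤ n + 1) {b : ℝ}
    (hb : b < upperExp (lattice Θ) (path 1 n) p) : ∃ᶠ s in atTop, b * s < logMin Θ p s := by
  refine ((frequently_lt_of_lt_limsup
    (isBoundedUnder_ge_psi Θ hp hpd).isCoboundedUnder_le hb).and_eventually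
      (eventually_gt_atTop 0)).mono fun s ⟨h, hs⟩ => ?_
  rwa [psi_eq_logMin_div, lt_div_iff₀ hs] at h

end Exponents

/-! ### Inequality (1): contracting lattice vectors -/

section FirstInequality

/-- Rounding is toward zero: rounding to the nearest integer could violate `|k| ≤ |t|`, which bounds
the last coordinates of `k • v` below. -/
theorem exists_int_truncation (t : ℝ) : ∃ k : ℤ, |t - k| ≤ 1 ∧ |(k : ℝ)| ≤ |t| := by
  rcases le_total 0 t with h | h
  · refine ⟨⌊t⌋, ?_, ?_⟩
    · rw [abs_of_nonneg (sub_nonneg.2 (Int.floor_le t))]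
      linarith [Int.lt_floor_add_one t]
    · rw [abs_of_nonneg (by exact_mod_cast Int.floor_nonneg.2 h), abs_of_nonneg h]
      exact Int.floor_le t
  · refine ⟨⌈t⌉, ?_, ?_⟩
    · rw [abs_of_nonpos (sub_nonpos.2 (Int.le_ceil t))]
      linarith [Int.ceil_lt_add_one t]
    · have : (⌈t⌉ : ℝ) ≤ 0 := by exact_mod_cast Int.ceil_le.2 (by simpa using h)
      rw [abs_of_nonpos this, abs_of_nonpos h]
      linarith [Int.le_ceil t]

/-- While a lattice vector contracts, the lattice modulo this vector expands uniformly. -/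
theorem shortSpan_le_of_contracting {v : Fin 1 ⊕ Fin n → ℝ} (hv : v ∈ lattice Θ)
    (hx : v (Sum.inl 0) ≠ 0) {s₀ s₁ t₀ t₁ : ℝ} (hs : s₁ ≤ s₀)
    (h1 : |v (Sum.inl 0)| ≤ Real.exp (s₁ + t₁))
    (h2 : ∀ i, |v (Sum.inr i)| ≤ |v (Sum.inl 0)| * Real.exp (-(s₀ + s₀ / n))) :
    shortSpan Θ s₀ t₀ ≤ shortSpan Θ s₁ (max t₁ (t₀ - (s₀ - s₁) / n + Real.log 2)) := by
  have hsn : s₁ / n ≤ s₀ / n := by gcongr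
  have hvm : v ∈ shortPoints Θ s₁ t₁ := by
    refine ⟨hv, h1, fun i => (h2 i).trans ?_⟩
    calc |v (Sum.inl 0)| * Real.exp (-(s₀ + s₀ / n))
        ≤ Real.exp (s₁ + t₁) * Real.exp (-(s₀ + s₀ / n)) := by gcongr
      _ ≤ Real.exp (t₁ - s₁ / n) := by
        rw [← Real.exp_add]
        exact Real.exp_le_exp.2 (by linarith)
  have hvs := Submodule.subset_span (R := ℝ) (shortPoints_mono
    (le_max_left t₁ (t₀ - (s₀ - s₁) / n + Real.log 2)) hvm)
  refine Submodule.span_le.2 ?_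
  rintro w ⟨hw, hw1, hw2⟩
  -- Division with remainder in the first coordinate: `w - k • v` has it at most that of `v`, and
  -- the other coordinates at most double.
  obtain ⟨k, hk1, hk2⟩ := exists_int_truncation (w (Sum.inl 0) / v (Sum.inl 0))
  have hxp : 0 < |v (Sum.inl 0)| := abs_pos.2 hx
  have hu : w - (k : ℝ) • v ∈
      shortPoints Θ s₁ (max t₁ (t₀ - (s₀ - s₁) / n + Real.log 2)) := by
    refine ⟨?_, ?_, fun i => ?_⟩
    · rw [Int.cast_smul_eq_zsmul]
      exact (lattice Θ).sub_mem hw ((lattice Θ).smul_mem k hv)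
    · have e : (w - (k : ℝ) • v) (Sum.inl 0) =
          v (Sum.inl 0) * (w (Sum.inl 0) / v (Sum.inl 0) - k) := by
        simp only [Pi.sub_apply, Pi.smul_apply, smul_eq_mul]
        field_simp
      rw [e, abs_mul]
      refine (mul_le_of_le_one_right hxp.le hk1).trans (h1.trans ?_)
      gcongr
      exact le_max_left _ _
    · have e1 : |(k : ℝ) * v (Sum.inr i)| ≤ Real.exp (t₀ - s₀ / n) := by
        rw [abs_mul]
        calc |(k : ℝ)| * |v (Sum.inr i)|
            ≤ |w (Sum.inl 0) / v (Sum.inl 0)| *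
              (|v (Sum.inl 0)| * Real.exp (-(s₀ + s₀ / n))) := by gcongr; exact h2 i
          _ = |w (Sum.inl 0)| * Real.exp (-(s₀ + s₀ / n)) := by rw [abs_div]; field_simp
          _ ≤ Real.exp (s₀ + t₀) * Real.exp (-(s₀ + s₀ / n)) := by gcongr
          _ = Real.exp (t₀ - s₀ / n) := by rw [← Real.exp_add]; congr 1; ring
      calc |(w - (k : ℝ) • v) (Sum.inr i)|
          ≤ |w (Sum.inr i)| + |(k : ℝ) * v (Sum.inr i)| := abs_sub _ _
        _ ≤ Real.exp (t₀ - s₀ / n) + Real.exp (t₀ - s₀ / n) := add_le_add (hw2 i) e1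
        _ = Real.exp (t₀ - s₀ / n) * 2 := by ring
        _ = Real.exp (t₀ - (s₀ - s₁) / n + Real.log 2 - s₁ / n) := by
          rw [← Real.exp_log (by norm_num : (0 : ℝ) < 2), ← Real.exp_add,
            Real.exp_log (by norm_num : (0 : ℝ) < 2)]
          congr 1
          ring
        _ ≤ _ := by gcongr; exact le_max_right _ _
  have := Submodule.add_mem _ (Submodule.subset_span (R := ℝ) hu)
    (Submodule.smul_mem _ (k : ℝ) hvs)
  rwa [sub_add_cancel] at this

/-- Since `t₁` lies below the `p`-th minimum at `s₁`, the other term of the maximum must be the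
relevant one. -/
theorem logMin_le_of_contracting {p : ℕ} (hp : 1 ≤ p) (hpd : p ≤ n + 1)
    {v : Fin 1 ⊕ Fin n → ℝ} (hv : v ∈ lattice Θ)
    (hx : v (Sum.inl 0) ≠ 0) {s₀ s₁ t₁ : ℝ} (hs₁ : 0 ≤ s₁) (hs : s₁ ≤ s₀)
    (h1 : |v (Sum.inl 0)| ≤ Real.exp (s₁ + t₁))
    (h2 : ∀ i, |v (Sum.inr i)| ≤ |v (Sum.inl 0)| * Real.exp (-(s₀ + s₀ / n)))
    (ht : t₁ < logMin Θ p s₁) :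
    logMin Θ p s₁ ≤ logMin Θ p s₀ - (s₀ - s₁) / n + Real.log 2 := by
  refine le_of_forall_pos_le_add fun ε hε => ?_
  have hr := le_finrank_of_logMin_lt (Θ := Θ) hp hpd (hs₁.trans hs)
    (lt_add_of_pos_right (logMin Θ p s₀) hε)
  have := logMin_le hp hpd hs₁
    (hr.trans (Submodule.finrank_mono (shortSpan_le_of_contracting hv hx hs h1 h2)))
  rcases le_max_iff.1 this with h | h
  · exact absurd ht h.not_gt
  · linarith

/-- Take for `s₀` the time at which the first coordinate and the largest other one have equal size
under the flow, or `s` if that is not reached before `s`. Since `|v (Sum.inl 0)|` is a nonzero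
integer, `s₀` grows linearly with `s`. -/
theorem exists_contracting_time (hn : 1 ≤ n) {v : Fin 1 ⊕ Fin n → ℝ} {s α : ℝ} (hs : 0 < s)
    (hα : α < 1 / n) (hv : v ∈ shortPoints Θ s (α * s)) (hv0 : v ≠ 0) :
    v (Sum.inl 0) ≠ 0 ∧ ∃ s₀, |v (Sum.inl 0)| ≤ Real.exp (s₀ + α * s₀) ∧
      (∀ i, |v (Sum.inr i)| ≤ |v (Sum.inl 0)| * Real.exp (-(s₀ + s₀ / n))) ∧
      (1 / n - α) * s ≤ s₀ * (1 + 1 / n) := by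
  obtain ⟨hvl, hv1, hv2⟩ := hv
  obtain ⟨q, a, hqa⟩ := mem_lattice_iff.1 hvl
  have hvx : v (Sum.inl 0) = q := by rw [hqa]; rfl
  have hneg : α * s - s / n < 0 := by
    have : α * s < 1 / n * s := by gcongr
    have e : 1 / (n : ℝ) * s = s / n := by ring
    linarith
  have hq : q ≠ 0 := by
    rintro rfl
    exact hv0 (eq_zero_of_abs_latticePoint_lt hqa fun i =>
      (hv2 i).trans_lt (Real.exp_lt_one_iff.2 hneg))
  have hx1 : 1 ≤ |v (Sum.inl 0)| := by
    rw [hvx]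
    exact_mod_cast Int.one_le_abs hq
  have hx0 : 0 < |v (Sum.inl 0)| := by linarith
  refine ⟨abs_pos.1 hx0, ?_⟩
  have hbound : ∀ s₀, |v (Sum.inl 0)| ≤ Real.exp (s₀ + α * s₀) → 0 ≤ s₀ + α * s₀ := fun s₀ h =>
    Real.one_le_exp_iff.1 (hx1.trans h)
  have hne : (Finset.univ : Finset (Fin n)).Nonempty := ⟨⟨0, hn⟩, Finset.mem_univ _⟩
  obtain ⟨j, -, hj⟩ := Finset.exists_max_image Finset.univ (fun i => |v (Sum.inr i)|) hne
  rcases le_or_gt |v (Sum.inr j)| (|v (Sum.inl 0)| * Real.exp (-(s + s / n))) with hc | hc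
  · refine ⟨s, hv1, fun i => (hj i (Finset.mem_univ i)).trans hc, ?_⟩
    have := hbound s hv1
    have e : 1 / (n : ℝ) * s = s * (1 / n) := by ring
    linarith
  · have hy0 : 0 < |v (Sum.inr j)| := lt_trans (by positivity) hc
    have hn0 : (0 : ℝ) < 1 + 1 / n := by positivity
    set s₀ := Real.log (|v (Sum.inl 0)| / |v (Sum.inr j)|) / (1 + 1 / n) with hs₀
    have e0 : s₀ * (1 + 1 / n) = Real.log (|v (Sum.inl 0)| / |v (Sum.inr j)|) := by
      rw [hs₀]; field_simp
    have e1 : s₀ + s₀ / n = Real.log (|v (Sum.inl 0)| / |v (Sum.inr j)|) := by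
      rw [← e0]; ring
    have hy : |v (Sum.inl 0)| * Real.exp (-(s₀ + s₀ / n)) = |v (Sum.inr j)| := by
      rw [Real.exp_neg, e1, Real.exp_log (by positivity)]
      field_simp
    have hss : s₀ < s := by
      rw [← hy] at hc
      have := Real.exp_lt_exp.1 (lt_of_mul_lt_mul_left hc hx0.le)
      have h3 : s₀ * (1 + 1 / n) < s * (1 + 1 / n) := by
        have e : ∀ z : ℝ, z * (1 + 1 / n) = z + z / n := fun z => by ring
        rw [e, e]; linarith
      exact lt_of_mul_lt_mul_right h3 hn0.le
    have hxe : |v (Sum.inl 0)| ≤ Real.exp (α * s - s / n + s₀ * (1 + 1 / n)) := by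
      have : |v (Sum.inl 0)| = |v (Sum.inr j)| * Real.exp (s₀ * (1 + 1 / n)) := by
        rw [e0, Real.exp_log (by positivity)]
        field_simp
      rw [this, Real.exp_add]
      gcongr
      exact hv2 j
    refine ⟨s₀, hxe.trans (Real.exp_le_exp.2 ?_), fun i =>
      (hj i (Finset.mem_univ i)).trans hy.ge, ?_⟩
    · have := mul_le_mul_of_nonneg_left hss.le (sub_pos.2 hα).le
      ring_nf at this ⊢
      linarith
    · have := Real.one_le_exp_iff.1 (hx1.trans hxe)
      ring_nf at this ⊢
      linarith

theorem le_upperExp_of_lt (hn : 1 ≤ n) {p : ℕ} (hp : 1 ≤ p) (hpd : p ≤ n + 1) {δ : ℝ}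
    (hδ0 : 0 < δ) (hδ1 : δ ≤ 1)
    (hα : lowerExp (lattice Θ) (path 1 n) 1 < 1 / n)
    (h : 1 + lowerExp (lattice Θ) (path 1 n) 1 < δ * (1 + lowerExp (lattice Θ) (path 1 n) p)) :
    lowerExp (lattice Θ) (path 1 n) p * δ + (1 - δ) / n ≤
      upperExp (lattice Θ) (path 1 n) p := by
  obtain ⟨α, hαe⟩ : ∃ α, α = lowerExp (lattice Θ) (path 1 n) 1 := ⟨_, rfl⟩
  obtain ⟨a, hae⟩ : ∃ a, a = lowerExp (lattice Θ) (path 1 n) p := ⟨_, rfl⟩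
  obtain ⟨b, hbe⟩ : ∃ b, b = upperExp (lattice Θ) (path 1 n) p := ⟨_, rfl⟩
  rw [← hαe] at hα h
  rw [← hae] at h ⊢
  rw [← hbe]
  by_contra! hlt
  obtain ⟨ε, hε, hε1, hε2, hε3⟩ : ∃ ε > 0, 3 * ε < δ * (1 + a) - (1 + α) ∧ ε < 1 / n - α ∧
      3 * ε < a * δ + (1 - δ) / n - b := by
    obtain ⟨ε, hε, h1⟩ := exists_between (show 0 < min ((δ * (1 + a) - (1 + α)) / 3)
      (min (1 / n - α) ((a * δ + (1 - δ) / n - b) / 3)) by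
        refine lt_min (by linarith) (lt_min (by linarith) (by linarith)))
    obtain ⟨h1, h2⟩ := lt_min_iff.1 h1
    obtain ⟨h2, h3⟩ := lt_min_iff.1 h2
    exact ⟨ε, hε, by linarith, by linarith, by linarith⟩
  have hδε : δ * ε ≤ ε := mul_le_of_le_one_left hε.le hδ1
  have hloc : lowerExp (lattice Θ) (path 1 n) p - ε < lowerExp (lattice Θ) (path 1 n) p := by
    linarith
  obtain ⟨S, hS⟩ := eventually_atTop.1 ((eventually_lt_logMin hp hpd hloc).and
    (eventually_logMin_lt (Θ := Θ) hp hpd (b := b + ε) (by linarith)))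
  -- For `s₀ ≥ K` both `δ * s₀` and `s₀` are past the threshold `S`, and `log 2` is absorbed into `ε
  -- * s₀`.
  set K := max (max (S / δ) S) (max (Real.log 2 / ε) 1) with hK
  have hn0 : (0 : ℝ) < 1 + 1 / n := by positivity
  have hgap : 0 < 1 / n - (α + ε) := by linarith
  obtain ⟨s, hsK, hs⟩ := frequently_atTop.1 (frequently_logMin_lt (Θ := Θ) le_rfl (by omega)
    (show lowerExp (lattice Θ) (path 1 n) 1 < α + ε by linarith))
    (max 1 (K * (1 + 1 / n) / (1 / n - (α + ε))))
  have hs0 : 0 < s := zero_lt_one.trans_le ((le_max_left _ _).trans hsK)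
  obtain ⟨v, hv, hv0⟩ := finrank_shortSpan_pos_iff.1
    (le_finrank_of_logMin_lt le_rfl (by omega) hs0.le hs)
  obtain ⟨hx, s₀, hx1, hy, hss⟩ := exists_contracting_time hn hs0 (by linarith) hv hv0
  have hKs : K ≤ s₀ := by
    have h1 := (le_max_right _ _).trans hsK
    rw [div_le_iff₀ hgap] at h1
    refine le_of_mul_le_mul_right (le_trans ?_ hss) hn0
    linarith
  have hs₀1 : 1 ≤ s₀ := (le_trans (le_max_right _ _) (le_max_right _ _)).trans hKs
  have hs₀S : S ≤ s₀ := (le_trans (le_max_right _ _) (le_max_left _ _)).trans hKs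
  have hδS : S ≤ δ * s₀ := by
    have := (le_trans (le_max_left _ _) (le_max_left _ _)).trans hKs
    rwa [div_le_iff₀ hδ0, mul_comm] at this
  have hlog : Real.log 2 ≤ ε * s₀ := by
    have := (le_trans (le_max_left _ _) (le_max_right _ _)).trans hKs
    rwa [div_le_iff₀ hε, mul_comm] at this
  have hs₀0 : 0 < s₀ := by linarith
  have h1 := (hS _ hδS).1
  have h2 := (hS _ hs₀S).2
  rw [← hae] at h1
  have ht : (α + ε + 1 - δ) * s₀ < (a - ε) * (δ * s₀) := by
    rw [← mul_assoc]
    gcongr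
    linarith
  -- `t₁` is chosen so that `s₁ + t₁ = s₀ + (α + ε) * s₀`, the known bound for the first coordinate
  -- of `v`.
  have h3 := logMin_le_of_contracting hp hpd hv.1 hx (s₁ := δ * s₀) (t₁ := (α + ε + 1 - δ) * s₀)
    (by positivity) (mul_le_of_le_one_left hs₀0.le hδ1)
    (hx1.trans (Real.exp_le_exp.2 (by linarith))) hy (ht.trans h1)
  have h4 : ((a - ε) * δ + (1 - δ) / n - (b + ε + ε)) * s₀ ≤ 0 := by
    have e : (s₀ - δ * s₀) / n = (1 - δ) / n * s₀ := by ring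
    rw [e] at h3
    linarith
  have h5 : 0 < (a - ε) * δ + (1 - δ) / n - (b + ε + ε) := by linarith
  exact absurd h4 (mul_pos h5 hs₀0).not_ge

theorem first_inequality (hn : 1 ≤ n) (Θ : Matrix (Fin n) (Fin 1) ℝ) {p : ℕ} (hp : 1 ≤ p)
    (hpd : p ≤ n + 1) :
    (1 + lowerExp (lattice Θ) (path 1 n) p) * (1 / n - upperExp (lattice Θ) (path 1 n) p) ≤
      (1 + lowerExp (lattice Θ) (path 1 n) 1) *
        (1 / n - lowerExp (lattice Θ) (path 1 n) p) := by
  have key := fun δ h0 h1 => le_upperExp_of_lt (Θ := Θ) (δ := δ) hn hp hpd h0 h1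
  have hab := lowerExp_le_upperExp (Θ := Θ) hp hpd
  have hb := upperExp_le (Θ := Θ) hp hpd
  have ha := neg_one_le_lowerExp (Θ := Θ) hp hpd
  have hα := neg_one_le_lowerExp (Θ := Θ) (p := 1) le_rfl (by omega)
  generalize lowerExp (lattice Θ) (path 1 n) p = a at *
  generalize upperExp (lattice Θ) (path 1 n) p = b at *
  generalize lowerExp (lattice Θ) (path 1 n) 1 = α at *
  rcases le_or_gt a α with h | h
  · exact mul_le_mul (by linarith) (by linarith) (by linarith) (by linarith)
  have ha1 : 0 < 1 + a := by linarith
  set δ₀ := (1 + α) / (1 + a) with hδ₀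
  have hδ₀1 : δ₀ < 1 := (div_lt_one ha1).2 (by linarith)
  have hδ₀0 : 0 ≤ δ₀ := div_nonneg (by linarith) ha1.le
  have hlim : ∀ δ, δ₀ < δ → δ < 1 → 1 / n - b ≤ (1 / n - a) * δ := by
    intro δ h1 h2
    have := key δ (hδ₀0.trans_lt h1) h2.le (by linarith) ((div_lt_iff₀ ha1).1 h1)
    ring_nf at this ⊢
    linarith
  -- The key bound needs `δ > δ₀` strictly; the endpoint, possibly `0`, follows by continuity.
  have hfin : 1 / n - b ≤ (1 / n - a) * δ₀ := by
    have ht : Tendsto (fun δ : ℝ => (1 / n - a) * δ) (nhdsWithin δ₀ (Set.Ioi δ₀))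
        (nhds ((1 / n - a) * δ₀)) :=
      ((continuous_const.mul continuous_id).tendsto δ₀).mono_left nhdsWithin_le_nhds
    refine ge_of_tendsto ht ?_
    filter_upwards [Ioo_mem_nhdsGT hδ₀1] with δ hδ
    exact hlim δ hδ.1 hδ.2
  calc (1 + a) * (1 / n - b) ≤ (1 + a) * ((1 / n - a) * δ₀) := by gcongr
    _ = (1 + α) * (1 / n - a) := by rw [hδ₀]; field_simp

end FirstInequality

/-! ### Inequality (2): expanding dual vectors -/

section SecondInequality

/-- While a dual vector expands, the section of the lattice by its kernel expands uniformly and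
contains all short vectors. -/
theorem shortSpan_le_of_expanding (hn : 1 ≤ n) {m : ℤ} {h : Fin n → ℤ}
    (h0 : (m : ℝ) + ∑ i, h i * Θ i 0 ≠ 0) {s₀ s₁ t : ℝ} (hs : s₀ ≤ s₁)
    (hh : ∀ i, |(h i : ℝ)| ≤ |m + ∑ i, h i * Θ i 0| * Real.exp (s₀ + s₀ / n))
    (hsmall : (n + 1) * |m + ∑ i, h i * Θ i 0| * Real.exp (s₁ + t) < 1) :
    shortSpan Θ s₁ t ≤ shortSpan Θ s₀ (t - (s₁ - s₀) / n + Real.log n) := by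
  obtain ⟨η, hη⟩ : ∃ η, η = (m : ℝ) + ∑ i, h i * Θ i 0 := ⟨_, rfl⟩
  rw [← hη] at h0 hh hsmall
  have hn1 : (1 : ℝ) ≤ n := by exact_mod_cast hn
  have hlog : 0 ≤ Real.log n := Real.log_nonneg hn1
  have hη0 : 0 < |η| := abs_pos.2 h0
  have hsn : s₀ / n ≤ s₁ / n := by gcongr
  refine Submodule.span_mono ?_
  rintro w ⟨hw, hw1, hw2⟩
  obtain ⟨q, a, hqa⟩ := mem_lattice_iff.1 hw
  have hsum : |∑ i, (h i : ℝ) * w (Sum.inr i)| ≤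
      n * (|η| * Real.exp (s₀ + s₀ / n) * Real.exp (t - s₁ / n)) := by
    calc |∑ i, (h i : ℝ) * w (Sum.inr i)| ≤ ∑ i, |(h i : ℝ) * w (Sum.inr i)| :=
          Finset.abs_sum_le_sum_abs _ _
      _ ≤ ∑ _i : Fin n, |η| * Real.exp (s₀ + s₀ / n) * Real.exp (t - s₁ / n) := by
          refine Finset.sum_le_sum fun i _ => ?_
          rw [abs_mul]
          exact mul_le_mul (hh i) (hw2 i) (abs_nonneg _) (by positivity)
      _ = _ := by simp
  -- The pairing of a dual and a lattice vector is an integer; being below 1 in absolute value, it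
  -- vanishes.
  have hint : η * w (Sum.inl 0) + ∑ i, (h i : ℝ) * w (Sum.inr i) =
      ((m * q + ∑ i, h i * a i : ℤ) : ℝ) := by
    rw [hqa, hη]
    simp only [latticePoint, Sum.elim_inl, Sum.elim_inr]
    push_cast
    rw [add_mul, Finset.sum_mul, add_assoc, ← Finset.sum_add_distrib]
    congr 1
    exact Finset.sum_congr rfl fun i _ => by ring
  have hzero : η * w (Sum.inl 0) + ∑ i, (h i : ℝ) * w (Sum.inr i) = 0 := by
    have hlt : |η * w (Sum.inl 0) + ∑ i, (h i : ℝ) * w (Sum.inr i)| < 1 := by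
      calc |η * w (Sum.inl 0) + ∑ i, (h i : ℝ) * w (Sum.inr i)|
          ≤ |η * w (Sum.inl 0)| + |∑ i, (h i : ℝ) * w (Sum.inr i)| := abs_add_le _ _
        _ ≤ |η| * Real.exp (s₁ + t) + n * (|η| * Real.exp (s₁ + t)) := by
          refine add_le_add ?_ (hsum.trans ?_)
          · rw [abs_mul]; gcongr
          · rw [mul_assoc, ← Real.exp_add]
            refine mul_le_mul_of_nonneg_left (mul_le_mul_of_nonneg_left
              (Real.exp_le_exp.2 ?_) hη0.le) (by positivity)
            linarith
        _ = (n + 1) * |η| * Real.exp (s₁ + t) := by ring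
        _ < 1 := hsmall
    rw [hint] at hlt ⊢
    have hlt' := Int.abs_lt_one_iff.1 (by exact_mod_cast hlt)
    rw [hlt', Int.cast_zero]
  refine ⟨hw, ?_, fun i => (hw2 i).trans (Real.exp_le_exp.2 ?_)⟩
  -- On the kernel the first coordinate is controlled by the others, which costs the factor `n`.
  · have e : |η| * |w (Sum.inl 0)| = |∑ i, (h i : ℝ) * w (Sum.inr i)| := by
      rw [← abs_mul, eq_neg_of_add_eq_zero_left hzero, abs_neg]
    rw [← e] at hsum
    refine le_of_mul_le_mul_left (hsum.trans (le_of_eq ?_)) hη0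
    have e2 : s₀ + (t - (s₁ - s₀) / n + Real.log n) =
        (s₀ + s₀ / n) + (t - s₁ / n) + Real.log n := by ring
    rw [e2, Real.exp_add (s₀ + s₀ / n + (t - s₁ / n)), Real.exp_add (s₀ + s₀ / n),
      Real.exp_log (by linarith)]
    ac_rfl
  · have e : (s₁ - s₀) / n = s₁ / n - s₀ / n := by ring
    linarith

/-- Dual to `exists_contracting_time`: `s₀` is the balance time of `η` and the largest `h i`, or `s`
if `η` already dominates. The bound on `η` persists at the later time because `β ≤ 1 / n`. -/
theorem exists_expanding_time (hn : 1 ≤ n) {η C s β : ℝ} {h : Fin n → ℝ} (hη : η ≠ 0)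
    (hβ : β ≤ 1 / n) (h1 : |η| ≤ C * Real.exp (-s - β * s))
    (h2 : ∀ i, |h i| ≤ C * Real.exp (s / n - β * s)) :
    ∃ s₀, s ≤ s₀ ∧ |η| ≤ C * Real.exp (-s₀ - β * s₀) ∧
      ∀ i, |h i| ≤ |η| * Real.exp (s₀ + s₀ / n) := by
  have hη0 : 0 < |η| := abs_pos.2 hη
  have hC : 0 < C := pos_of_mul_pos_left (hη0.trans_le h1) (Real.exp_pos _).le
  have hne : (Finset.univ : Finset (Fin n)).Nonempty := ⟨⟨0, hn⟩, Finset.mem_univ _⟩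
  obtain ⟨j, -, hj⟩ := Finset.exists_max_image Finset.univ (fun i => |h i|) hne
  rcases le_or_gt |h j| (|η| * Real.exp (s + s / n)) with hc | hc
  · exact ⟨s, le_rfl, h1, fun i => (hj i (Finset.mem_univ i)).trans hc⟩
  · have hy0 : 0 < |h j| := lt_trans (by positivity) hc
    have hn0 : (0 : ℝ) < 1 + 1 / n := by positivity
    set s₀ := Real.log (|h j| / |η|) / (1 + 1 / n) with hs₀
    have e1 : s₀ + s₀ / n = Real.log (|h j| / |η|) := by
      have : s₀ * (1 + 1 / n) = Real.log (|h j| / |η|) := by rw [hs₀]; field_simp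
      rw [← this]; ring
    have hy : |η| * Real.exp (s₀ + s₀ / n) = |h j| := by
      rw [e1, Real.exp_log (by positivity)]
      field_simp
    have hss : s < s₀ := by
      rw [← hy] at hc
      have := Real.exp_lt_exp.1 (lt_of_mul_lt_mul_left hc hη0.le)
      have h3 : s * (1 + 1 / n) < s₀ * (1 + 1 / n) := by
        have e : ∀ z : ℝ, z * (1 + 1 / n) = z + z / n := fun z => by ring
        rw [e, e]; linarith
      exact lt_of_mul_lt_mul_right h3 hn0.le
    refine ⟨s₀, hss.le, ?_, fun i => (hj i (Finset.mem_univ i)).trans hy.ge⟩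
    have e2 : |η| = |h j| * Real.exp (-(s₀ + s₀ / n)) := by
      rw [← hy, mul_assoc, ← Real.exp_add]; simp
    calc |η| ≤ C * Real.exp (s / n - β * s) * Real.exp (-(s₀ + s₀ / n)) := by
          rw [e2]; gcongr; exact h2 j
      _ = C * Real.exp (s / n - β * s - (s₀ + s₀ / n)) := by
          rw [mul_assoc, ← Real.exp_add]; rfl
      _ ≤ C * Real.exp (-s₀ - β * s₀) := by
          refine mul_le_mul_of_nonneg_left (Real.exp_le_exp.2 ?_) hC.le
          have := mul_le_mul_of_nonneg_left hss.le (sub_nonneg.2 hβ)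
          ring_nf at this ⊢
          linarith

theorem dual_ne_zero_of_linearIndependent
    (hli : LinearIndependent ℚ (Fin.cons 1 (fun i => Θ i 0) : Fin (n + 1) → ℝ)) {m : ℤ}
    {h : Fin n → ℤ} (hmh : ¬ (m = 0 ∧ h = 0)) : (m : ℝ) + ∑ i, h i * Θ i 0 ≠ 0 := by
  intro h0
  have := Fintype.linearIndependent_iff.1 hli (Fin.cons (m : ℚ) (fun i => (h i : ℚ))) (by
    rw [Fin.sum_univ_succ]
    simpa [Rat.smul_def] using h0)
  refine hmh ⟨by simpa using this 0, ?_⟩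
  funext i
  simpa using this i.succ

/-- Compare the times `s₀` and `γ * s₀`. The strict hypothesis says that the dual vector still
annihilates the points realising the `p`-th minimum at the later time. -/
theorem lowerExp_le_of_lt (hn : 1 ≤ n)
    (hli : LinearIndependent ℚ (Fin.cons 1 (fun i => Θ i 0) : Fin (n + 1) → ℝ)) {p : ℕ}
    (hp : 1 ≤ p) (hpd : p ≤ n + 1) {γ : ℝ} (hγ : 1 ≤ γ)
    (h : γ * (1 + upperExp (lattice Θ) (path 1 n) p) <
      1 + upperExp (lattice Θ) (path 1 n) (n + 1)) :
    lowerExp (lattice Θ) (path 1 n) p + (γ - 1) / n ≤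
      upperExp (lattice Θ) (path 1 n) p * γ := by
  obtain ⟨β, hβe⟩ : ∃ β, β = upperExp (lattice Θ) (path 1 n) (n + 1) := ⟨_, rfl⟩
  obtain ⟨a, hae⟩ : ∃ a, a = lowerExp (lattice Θ) (path 1 n) p := ⟨_, rfl⟩
  obtain ⟨b, hbe⟩ : ∃ b, b = upperExp (lattice Θ) (path 1 n) p := ⟨_, rfl⟩
  have hβn : β ≤ 1 / n := hβe ▸ upperExp_le (by omega) le_rfl
  rw [← hbe, ← hβe] at h
  rw [← hae, ← hbe]
  by_contra! hlt
  have hγ0 : 0 < γ := by linarith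
  obtain ⟨ε, hε, hε1, hε2⟩ : ∃ ε > 0, (1 + γ) * ε < (1 + β) - γ * (1 + b) ∧
      (2 + γ) * ε < a + (γ - 1) / n - b * γ := by
    obtain ⟨ε, hε, h1⟩ := exists_between (show 0 < min (((1 + β) - γ * (1 + b)) / (1 + γ))
      ((a + (γ - 1) / n - b * γ) / (2 + γ)) by
        refine lt_min (div_pos (by linarith) (by linarith)) (div_pos (by linarith) (by linarith)))
    obtain ⟨h1, h2⟩ := lt_min_iff.1 h1
    rw [lt_div_iff₀ (by linarith), mul_comm] at h1 h2
    exact ⟨ε, hε, h1, h2⟩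
  obtain ⟨C, hC, hdual⟩ := exists_short_dual n
  obtain ⟨S, hS⟩ := eventually_atTop.1 ((eventually_lt_logMin (Θ := Θ) hp hpd (a := a - ε)
    (by linarith)).and (eventually_logMin_lt (Θ := Θ) hp hpd (b := b + ε) (by linarith)))
  -- The bound on the pairing is `(n + 1) * C * exp (-κ * s₀)`, so `κ > 0` makes it less than 1 for
  -- large `s₀`.
  set κ := (1 + (β - ε)) - γ * (1 + (b + ε)) with hκ
  have hκ0 : 0 < κ := by rw [hκ]; linarith
  obtain ⟨s, hsK, hs⟩ := frequently_atTop.1 (frequently_lt_logMin (Θ := Θ) (p := n + 1)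
    (b := β - ε) (by omega) le_rfl (by linarith))
    (max (max S 1) (max (Real.log ((n + 1) * C) / κ + 1) (Real.log n / ε)))
  have hs1 : 1 ≤ s := (le_trans (le_max_right _ _) (le_max_left _ _)).trans hsK
  obtain ⟨m, h', hne, hm, hh⟩ := hdual Θ s ((β - ε) * s) (by
    by_contra! hge
    exact absurd hs (logMin_le (by omega) le_rfl (by linarith) hge).not_gt)
  have hη := dual_ne_zero_of_linearIndependent hli hne
  obtain ⟨s₀, hss, hm₀, hh₀⟩ := exists_expanding_time hn hη (by linarith : β - ε ≤ 1 / n) hm hh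
  have hs₀S : S ≤ s₀ := ((le_trans (le_max_left _ _) (le_max_left _ _)).trans hsK).trans hss
  have hs₀log : Real.log n ≤ ε * s₀ := by
    have := ((le_trans (le_max_right _ _) (le_max_right _ _)).trans hsK).trans hss
    rwa [div_le_iff₀ hε, mul_comm] at this
  have hs₀κ : Real.log ((n + 1) * C) < κ * s₀ := by
    have := ((le_trans (le_max_left _ _) (le_max_right _ _)).trans hsK).trans hss
    rw [mul_comm κ, ← div_lt_iff₀ hκ0]
    linarith
  have hs₀0 : 0 < s₀ := by linarith
  have hγs : s₀ ≤ γ * s₀ := le_mul_of_one_le_left hs₀0.le hγ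
  have hnC : 0 < ((n : ℝ) + 1) * C := by positivity
  have hsmall : (n + 1) * |m + ∑ i, h' i * Θ i 0| *
      Real.exp (γ * s₀ + (b + ε) * (γ * s₀)) < 1 := by
    calc (n + 1) * |m + ∑ i, h' i * Θ i 0| * Real.exp (γ * s₀ + (b + ε) * (γ * s₀))
        ≤ (n + 1) * (C * Real.exp (-s₀ - (β - ε) * s₀)) *
          Real.exp (γ * s₀ + (b + ε) * (γ * s₀)) := by gcongr
      _ = Real.exp (Real.log ((n + 1) * C) - κ * s₀) := by
        have e : Real.log ((n + 1) * C) - κ * s₀ = Real.log ((n + 1) * C) +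
            ((-s₀ - (β - ε) * s₀) + (γ * s₀ + (b + ε) * (γ * s₀))) := by rw [hκ]; ring
        rw [e, Real.exp_add (Real.log _), Real.exp_log hnC, Real.exp_add (-s₀ - (β - ε) * s₀)]
        ac_rfl
      _ < 1 := Real.exp_lt_one_iff.2 (by linarith)
  have h1 := (hS _ hs₀S).1
  have h2 := (hS _ (hs₀S.trans hγs)).2
  have h3 := logMin_le hp hpd hs₀0.le
    ((le_finrank_of_logMin_lt (Θ := Θ) hp hpd (hs₀0.le.trans hγs) h2).trans
      (Submodule.finrank_mono (shortSpan_le_of_expanding hn hη hγs hh₀ hsmall)))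
  have h4 : ((a - ε) + (γ - 1) / n - (b + ε) * γ - ε) * s₀ ≤ 0 := by
    have e : (γ * s₀ - s₀) / n = (γ - 1) / n * s₀ := by ring
    rw [e] at h3
    linarith
  have h5 : 0 < (a - ε) + (γ - 1) / n - (b + ε) * γ - ε := by linarith
  exact absurd h4 (mul_pos h5 hs₀0).not_ge

theorem second_inequality (hn : 1 ≤ n)
    (hli : LinearIndependent ℚ (Fin.cons 1 (fun i => Θ i 0) : Fin (n + 1) → ℝ)) {p : ℕ}
    (hp : 1 ≤ p) (hpd : p ≤ n + 1) :
    (1 + upperExp (lattice Θ) (path 1 n) (n + 1)) *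
        (1 / n - upperExp (lattice Θ) (path 1 n) p) ≤
      (1 + upperExp (lattice Θ) (path 1 n) p) *
        (1 / n - lowerExp (lattice Θ) (path 1 n) p) := by
  have key := fun γ h0 => lowerExp_le_of_lt (γ := γ) hn hli hp hpd h0
  have hab := lowerExp_le_upperExp (Θ := Θ) hp hpd
  have hb := upperExp_le (Θ := Θ) hp hpd
  have ha := neg_one_le_lowerExp (Θ := Θ) hp hpd
  generalize upperExp (lattice Θ) (path 1 n) (n + 1) = β at *
  generalize lowerExp (lattice Θ) (path 1 n) p = a at *
  generalize upperExp (lattice Θ) (path 1 n) p = b at *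
  have hn0 : (0 : ℝ) < 1 / n := by positivity
  rcases le_or_gt β b with h | h
  · exact mul_le_mul (by linarith) (by linarith) (by linarith) (by linarith)
  have hlim : ∀ γ, 1 ≤ γ → γ * (1 + b) < 1 + β → γ * (1 / n - b) ≤ 1 / n - a := by
    intro γ h1 h2
    have := key γ h1 h2
    ring_nf at this ⊢
    linarith
  rcases (show (0 : ℝ) ≤ 1 + b by linarith).eq_or_lt with hb0 | hb0
  -- If `b = -1`, every `γ ≥ 1` is admissible, and a large `γ` contradicts `hlim`.
  · exfalso
    have hb1 : b = -1 := by linarith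
    have := hlim (1 + (1 / n - a) / (1 / n - b))
      (le_add_of_nonneg_right (div_nonneg (by linarith) (by linarith))) (by
        rw [← hb0, mul_zero]; linarith)
    rw [add_mul, div_mul_cancel₀ _ (by linarith)] at this
    linarith
  set γ₀ := (1 + β) / (1 + b) with hγ₀
  have hγ₀1 : 1 < γ₀ := (one_lt_div hb0).2 (by linarith)
  have hfin : γ₀ * (1 / n - b) ≤ 1 / n - a := by
    have ht : Tendsto (fun γ : ℝ => γ * (1 / n - b)) (nhdsWithin γ₀ (Set.Iio γ₀))
        (nhds (γ₀ * (1 / n - b))) :=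
      ((continuous_id.mul continuous_const).tendsto γ₀).mono_left nhdsWithin_le_nhds
    refine le_of_tendsto ht ?_
    filter_upwards [Ioo_mem_nhdsLT hγ₀1] with γ hγ
    exact hlim γ hγ.1.le ((lt_div_iff₀ hb0).1 hγ.2)
  calc (1 + β) * (1 / n - b) = (1 + b) * (γ₀ * (1 / n - b)) := by rw [hγ₀]; field_simp
    _ ≤ (1 + b) * (1 / n - a) := by gcongr

end SecondInequality

end SchmidtSummerer

theorem theorem1 (n : ℕ) (hn : 1 ≤ n) (Θ : Matrix (Fin n) (Fin 1) ℝ)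
    (p : ℕ) (hp : 1 ≤ p) (hpd : p ≤ n + 1) :
    -- the lower and upper limits defining the exponents are genuine (finite)
    (∀ q : ℕ, 1 ≤ q → q ≤ n + 1 →
      IsBoundedUnder (· ≤ ·) atTop
        (SchmidtSummerer.psi (SchmidtSummerer.lattice Θ) (SchmidtSummerer.path 1 n) q) ∧
      IsBoundedUnder (· ≥ ·) atTop
        (SchmidtSummerer.psi (SchmidtSummerer.lattice Θ) (SchmidtSummerer.path 1 n) q)) ∧
    -- both inequalities, for `1, θ_1, …, θ_n` linearly independent over `ℚ`
    (LinearIndependent ℚ (Fin.cons 1 (fun i => Θ i 0) : Fin (n + 1) → ℝ) →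
      (1 + SchmidtSummerer.lowerExp (SchmidtSummerer.lattice Θ) (SchmidtSummerer.path 1 n) p) *
          (1 / n - SchmidtSummerer.upperExp (SchmidtSummerer.lattice Θ)
            (SchmidtSummerer.path 1 n) p) ≤
        (1 + SchmidtSummerer.lowerExp (SchmidtSummerer.lattice Θ) (SchmidtSummerer.path 1 n) 1) *
          (1 / n - SchmidtSummerer.lowerExp (SchmidtSummerer.lattice Θ)
            (SchmidtSummerer.path 1 n) p) ∧
      (1 + SchmidtSummerer.upperExp (SchmidtSummerer.lattice Θ)
            (SchmidtSummerer.path 1 n) (n + 1)) *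
          (1 / n - SchmidtSummerer.upperExp (SchmidtSummerer.lattice Θ)
            (SchmidtSummerer.path 1 n) p) ≤
        (1 + SchmidtSummerer.upperExp (SchmidtSummerer.lattice Θ) (SchmidtSummerer.path 1 n) p) *
          (1 / n - SchmidtSummerer.lowerExp (SchmidtSummerer.lattice Θ)
            (SchmidtSummerer.path 1 n) p)) ∧
    -- the first inequality under the weaker hypothesis on the dimension
    (p ≤ Module.finrank ℚ
        (Submodule.span ℚ (Set.range (Fin.cons 1 (fun i => Θ i 0) : Fin (n + 1) → ℝ))) →
      (1 + SchmidtSummerer.lowerExp (SchmidtSummerer.lattice Θ) (SchmidtSummerer.path 1 n) p) *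
          (1 / n - SchmidtSummerer.upperExp (SchmidtSummerer.lattice Θ)
            (SchmidtSummerer.path 1 n) p) ≤
        (1 + SchmidtSummerer.lowerExp (SchmidtSummerer.lattice Θ) (SchmidtSummerer.path 1 n) 1) *
          (1 / n - SchmidtSummerer.lowerExp (SchmidtSummerer.lattice Θ)
            (SchmidtSummerer.path 1 n) p)) := by
  have first := SchmidtSummerer.first_inequality hn Θ hp hpd
  exact ⟨fun q hq hqd => ⟨SchmidtSummerer.isBoundedUnder_le_psi Θ hq hqd,
    SchmidtSummerer.isBoundedUnder_ge_psi Θ hq hqd⟩,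
    fun hli => ⟨first, SchmidtSummerer.second_inequality hn hli hp hpd⟩, fun _ => first⟩
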